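/- Let $A$ be a finitely generated abelian group (written multiplicatively) and $M$ a tame $\mathbb Z[A]$-module: $M$ is finitely generated over $\mathbb Z[A]$ and, for every nonzero homomorphism $v:A\to\mathbb R$, $M$ is finitely generated over $\mathbb Z[A_v]$ or over $\mathbb Z[A_{-v}]$, where $A_v=\{a\in A: v(a)\ge 0\}$. Let $0\to M\to G\to A\to 1$ be a short exact sequence of groups in which the $A$-module structure of $M$ is given by conjugation. Let $R=\mathbb Z[J^{-1}]$ for a set $J$ of primes, or $R=\mathbb Z/n$ with $n\ge 1$, and let $K$ be an Artinian quotient ring of $R$. Notation. $I_k$ is the augmentation ideal of $k[A]$; $M_K=M\otimes K$; $\hat M_K=\varprojlim_m M_K/M_KI_K^m$; $M_K^{\ell}=M_K[(1+I_K)^{-1}]$; $\wedge^2$ is the exterior square over $\mathbb Z$ with the diagonal action, and $(-)_H$ denotes coinvariants. If $R=\mathbb Z[J^{-1}]$: let $\hat A_R=t_m^R(A)=A\otimes R$ and $\mathcal M^m=(M\otimes R)/((\gamma_m(G)\cap M)\otimes R)$, where $\gamma_m(G)$ is the lower central series, $\gamma_1(G)=G$. Let $\theta_R$ be the unique homomorphism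 from $A\otimes R$ to the group $1+\hat I_R$ of units of the $I_R$-adic completion $\widehat{R[A]}$ that extends the natural map from $A$. If $R=\mathbb Z/n$: let $\hat A_R=\varprojlim_i A/A^{n^i}$, $t_m^R(A)=A/A^{n^m}$ and $\mathcal M^m=M/(\gamma_m^{[n]}(G)\cap M)$, where $\gamma_1^{[n]}(G)=G$ and $\gamma_{i+1}^{[n]}(G)$ is generated by $[\gamma_i^{[n]}(G),G]$ and the $n$-th powers of elements of $\gamma_i^{[n]}(G)$. Let $S=\mathbb Z[p^{-1}: p \text{ prime},\ p\nmid n]$ and let $\theta_R:\hat A_R\to\widehat{S[A]}$ be the homomorphism to the completion at $\ker(S[A]\to\mathbb Z/n)$ induced by the maps $A/A^{n^i}\to S[A]/\ker(S[A]\to\mathbb Z/n)^i$. Put $\mathcal M_K^m=\mathcal M^m\otimes K$. The group $\hat A_R$ acts on $\hat M_K$ through $\theta_R$ and the natural map to $\widehat{K[A]}$. If $R=\mathbb Z[J^{-1}]$, then $t^R_m(A)=A\otimes R$ acts in the same way on the $K[A]$-module $\mathcal M^m_K$, which is annihilated by $I_K^m$ and hence complete; if $R=\mathbb Z/n$, then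 $t_m^R(A)=A/A^{n^m}$ acts on $\mathcal M_K^m$ through the action of $A$. Then $$(\wedge^2\hat M_K)_{\hat A_R}=(\wedge^2\hat M_K)_A$$ (the two groups are the same quotient of $\wedge^2\hat M_K$), the canonical map $M_K^\ell\to\hat M_K$ induces an isomorphism $$(\wedge^2M_K^\ell)_A\cong(\wedge^2\hat M_K)_A,$$ and there is $m_0$ such that for all $m\ge m_0$ the canonical maps $\hat M_K\to M_K/M_KI_K^m\to\mathcal M_K^m$ induce isomorphisms $$(\wedge^2\hat M_K)_A\cong(\wedge^2(M_K/M_KI_K^m))_A\cong(\wedge^2\mathcal M_K^m)_{t_m^R(A)}.$$ -/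

import Mathlib

open scoped TensorProduct commutatorElement

noncomputable section

namespace Metabelian

universe u v w z

/-! ### Group rings and extension of scalars -/

/-- The ring homomorphism `k[A] → k'[A]` induced by a ring homomorphism `k → k'`. -/
abbrev grMap (A : Type*) [CommGroup A] {k k' : Type*} [CommRing k] [CommRing k'] (f : k →+* k') :
    MonoidAlgebra k A →+* MonoidAlgebra k' A :=
  MonoidAlgebra.mapRingHom A f

/-- The augmentation `k[A] → k`. -/
def augmentation (k A : Type*) [CommRing k] [CommGroup A] : MonoidAlgebra k A →+* k :=
  (MonoidAlgebra.lift k k A 1).toRingHom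

/-- The augmentation ideal `I_k` of `k[A]`. -/
def augIdeal (k A : Type*) [CommRing k] [CommGroup A] : Ideal (MonoidAlgebra k A) :=
  RingHom.ker (augmentation k A)

/-- Extension of scalars `Λ' ⊗_Λ M` along a ring homomorphism `f : Λ → Λ'`. For
`f : k[A] → k'[A]` this is `M ⊗_k k'` with its `k'[A]`-module structure. -/
def ExtendScalars {Λ Λ' : Type*} [CommRing Λ] [CommRing Λ'] (f : Λ →+* Λ')
    (M : Type*) [AddCommGroup M] [Module Λ M] : Type _ :=
  letI := f.toAlgebra
  Λ' ⊗[Λ] M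

namespace ExtendScalars

variable {Λ Λ' : Type*} [CommRing Λ] [CommRing Λ'] (f : Λ →+* Λ')
    (M : Type*) [AddCommGroup M] [Module Λ M]

instance : AddCommGroup (ExtendScalars f M) :=
  letI := f.toAlgebra
  (TensorProduct.addCommGroup : AddCommGroup (Λ' ⊗[Λ] M))

instance : Module Λ' (ExtendScalars f M) :=
  letI := f.toAlgebra
  (TensorProduct.leftModule : Module Λ' (Λ' ⊗[Λ] M))

/-- The canonical map `x ↦ 1 ⊗ x`. -/
def unit : M →ₛₗ[f] ExtendScalars f M :=
  letI := f.toAlgebra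
  { toFun := fun x => (1 : Λ') ⊗ₜ[Λ] x
    map_add' := fun x y => TensorProduct.tmul_add _ x y
    map_smul' := fun r x => by
      change (1 : Λ') ⊗ₜ[Λ] (r • x) = f r • ((1 : Λ') ⊗ₜ[Λ] x)
      rw [← TensorProduct.smul_tmul, TensorProduct.smul_tmul']
      rfl }

variable {M} {N : Type*} [AddCommGroup N] [Module Λ' N]

/-- The `Λ'`-linear map `c ⊗ x ↦ c • g x`. -/
def lift (g : M →ₛₗ[f] N) : ExtendScalars f M →ₗ[Λ'] N :=
  letI := f.toAlgebra
  letI : Module Λ N := Module.compHom N f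
  haveI : IsScalarTower Λ Λ' N := ⟨fun r s x => by
    change (f r * s) • x = f r • (s • x)
    rw [mul_smul]⟩
  LinearMap.liftBaseChange Λ' (M := M) (N := N)
    { toFun := g, map_add' := g.map_add, map_smul' := g.map_smulₛₗ }

theorem lift_unit (g : M →ₛₗ[f] N) (x : M) : lift f g (unit f M x) = g x := by
  let := f.toAlgebra
  let : Module Λ N := Module.compHom N f
  have : IsScalarTower Λ Λ' N := ⟨fun r s x => by
    change (f r * s) • x = f r • (s • x)
    rw [mul_smul]⟩
  change LinearMap.liftBaseChange Λ' _ _ = _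
  exact (LinearMap.liftBaseChange_tmul _ _ _ _).trans (one_smul _ _)

theorem span_range_unit : Submodule.span Λ' (Set.range (unit f M)) = ⊤ := by
  let := f.toAlgebra
  rw [eq_top_iff]
  rintro x -
  change Λ' ⊗[Λ] M at x
  induction x using TensorProduct.induction_on with
  | zero => exact Submodule.zero_mem _
  | add x y hx hy => exact Submodule.add_mem _ hx hy
  | tmul c x =>
    have h : c ⊗ₜ[Λ] x = c • ((1 : Λ') ⊗ₜ[Λ] x) := by
      rw [TensorProduct.smul_tmul', smul_eq_mul, mul_one]
    rw [h]
    exact Submodule.smul_mem _ _ (Submodule.subset_span ⟨x, rfl⟩)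

end ExtendScalars

/-! ### Tame modules -/

section Tame

variable (A : Type u) [CommGroup A] (M : Type v) [AddCommGroup M] [Module (MonoidAlgebra ℤ A) M]

/-- The valuation monoid `A_v = {a | 0 ≤ v a}` of `v : A → ℝ`. -/
def valuationMonoid (v : Additive A →+ ℝ) : Submonoid A where
  carrier := {a | 0 ≤ v (Additive.ofMul a)}
  one_mem' := by simp
  mul_mem' := fun {a b} ha hb => by
    simp only [Set.mem_ofPred_eq, ofMul_mul, map_add] at *
    exact add_nonneg ha hb

/-- The set of nonzero valuations `v` such that `M` is finitely generated over `ℤ[A_v]`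
(viewed as a subring of `ℤ[A]`). It is a union of rays, and its image in the valuation
sphere is the Bieri-Strebel invariant `Σ(M)`. -/
def bieriStrebel : Set (Additive A →+ ℝ) :=
  {v | v ≠ 0 ∧ Module.Finite
    (MonoidAlgebra.mapDomainAlgHom ℤ ℤ (valuationMonoid A v).subtype).range M}

/-- A tame module: finitely generated over `ℤ[A]`, with `Σ(M) ∪ -Σ(M)` the whole sphere. -/
structure IsTame : Prop where
  finite : Module.Finite (MonoidAlgebra ℤ A) M
  sphere : bieriStrebel A M ∪ {v | -v ∈ bieriStrebel A M} = {v | v ≠ 0}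

end Tame

/-! ### Metabelian decompositions -/

/-- A short exact sequence `0 → M → G → A → 1` in which the `A`-module structure of `M` is
given by conjugation, `ι (m * π g) = g⁻¹ * ι m * g`. -/
structure Decomposition (A : Type u) [CommGroup A] (M : Type v) [AddCommGroup M]
    [Module (MonoidAlgebra ℤ A) M] (G : Type w) [Group G] where
  ι : Multiplicative M →* G
  π : G →* A
  ι_injective : Function.Injective ι
  π_surjective : Function.Surjective π
  exact : ι.range = π.ker
  conj : ∀ (g : G) (x : M), ι (Multiplicative.ofAdd (MonoidAlgebra.of ℤ A (π g) • x)) =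
    g⁻¹ * ι (Multiplicative.ofAdd x) * g

/-- The lower central series with the indexing `γ 1 = G`, `γ (i+1) = [γ i, G]`
(and `γ 0 = G`). -/
def gammaZ (G : Type w) [Group G] (i : ℕ) : Subgroup G :=
  (⊤ : Subgroup G).lowerCentralSeries (i - 1)

/-- Auxiliary indexing of the `n`-lower central series, starting with `G` at `0`. -/
def gammaModAux (n : ℕ) (G : Type w) [Group G] : ℕ → Subgroup G
  | 0 => ⊤
  | i + 1 => Subgroup.normalClosure {x | ∃ h ∈ gammaModAux n G i, h ^ n = x} ⊔
      ⁅gammaModAux n G i, ⊤⁆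

/-- The `n`-lower central series with the indexing `γ 1 = G`; `γ (i+1)` is generated by the
`n`-th powers of elements of `γ i` and by `[γ i, G]` (and `γ 0 = G`). -/
def gammaMod (n : ℕ) (G : Type w) [Group G] (i : ℕ) : Subgroup G :=
  gammaModAux n G (i - 1)

theorem gammaModAux_normal (n : ℕ) (G : Type w) [Group G] (i : ℕ) : (gammaModAux n G i).Normal := by
  induction i with
  | zero => exact (inferInstance : (⊤ : Subgroup G).Normal)
  | succ i ih =>
    change (_ ⊔ _ : Subgroup G).Normal
    infer_instance

instance (n : ℕ) (G : Type w) [Group G] (i : ℕ) : (gammaMod n G i).Normal :=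
  gammaModAux_normal n G _

instance (G : Type w) [Group G] (i : ℕ) : (gammaZ G i).Normal := by
  unfold gammaZ
  infer_instance

section Filtration

variable {A : Type u} [CommGroup A] {M : Type v} [AddCommGroup M]
  [Module (MonoidAlgebra ℤ A) M] {G : Type w} [Group G] (D : Decomposition A M G)

/-- The submodule `H ∩ M` of `M`, for a normal subgroup `H` of `G`. -/
def Decomposition.inter (H : Subgroup G) [H.Normal] : Submodule (MonoidAlgebra ℤ A) M where
  carrier := {x | D.ι (Multiplicative.ofAdd x) ∈ H}
  zero_mem' := by
    change D.ι 1 ∈ H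
    rw [map_one]
    exact H.one_mem
  add_mem' := fun {x y} hx hy => by
    simp only [Set.mem_ofPred_eq, ofAdd_add, map_mul] at *
    exact H.mul_mem hx hy
  smul_mem' := fun c x hx => by
    induction c using MonoidAlgebra.induction_on with
    | of a =>
      obtain ⟨g, rfl⟩ := D.π_surjective a
      simp only [Set.mem_ofPred_eq] at *
      rw [D.conj]
      have := Subgroup.Normal.conj_mem (inferInstance : H.Normal) _ hx g⁻¹
      simpa using this
    | add c d hc hd =>
      simp only [Set.mem_ofPred_eq, add_smul, ofAdd_add, map_mul] at *
      exact H.mul_mem hc hd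
    | smul r c hc =>
      simp only [Set.mem_ofPred_eq, smul_assoc, ofAdd_zsmul, map_zpow] at *
      exact H.zpow_mem hc r

theorem Decomposition.inter_top : D.inter ⊤ = ⊤ :=
  top_unique fun x _ => Subgroup.mem_top (D.ι (Multiplicative.ofAdd x))

theorem Decomposition.sub_one_smul_mem (H H' : Subgroup G) [H.Normal] [H'.Normal]
    (h : ⁅H, (⊤ : Subgroup G)⁆ ≤ H') (a : A) {x : M} (hx : x ∈ D.inter H) :
    (MonoidAlgebra.of ℤ A a - 1) • x ∈ D.inter H' := by
  obtain ⟨g, rfl⟩ := D.π_surjective a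
  change D.ι (Multiplicative.ofAdd _) ∈ H'
  change D.ι (Multiplicative.ofAdd x) ∈ H at hx
  rw [sub_smul, one_smul, ofAdd_sub]
  rw [map_div, D.conj]
  set y := D.ι (Multiplicative.ofAdd x)
  have h1 := h (Subgroup.commutator_mem_commutator hx (Subgroup.mem_top g⁻¹))
  have h2 := H'.inv_mem h1
  have e : g⁻¹ * y * g / y = (⁅y, g⁻¹⁆)⁻¹ := by
    rw [commutatorElement_def, div_eq_mul_inv]
    group
  rwa [e]

end Filtration

/-! ### The coefficient rings `ℤ[J⁻¹]` -/

/-- The multiplicative set generated by the elements of `J`. -/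
def multSet (J : Set ℕ) : Submonoid ℤ := Submonoid.closure ((fun p : ℕ => (p : ℤ)) '' J)

/-- The ring `ℤ[J⁻¹]`. -/
def ZInv (J : Set ℕ) : Type := Localization (multSet J)

instance (J : Set ℕ) : CommRing (ZInv J) :=
  (inferInstance : CommRing (Localization (multSet J)))

instance (J : Set ℕ) : IsLocalization (multSet J) (ZInv J) := by
  have h : IsLocalization (multSet J) (Localization (multSet J)) := inferInstance
  have e : (OreLocalization.instAlgebra : Algebra ℤ (Localization (multSet J))) =
    Ring.toIntAlgebra (ZInv J) := Subsingleton.elim _ _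
  rw [e] at h
  exact h

instance (J : Set ℕ) : IsNoetherianRing (ZInv J) :=
  IsLocalization.isNoetherianRing (multSet J) _ inferInstance

/-- The set of primes that do not divide `n`. -/
def primesNot (n : ℕ) : Set ℕ := {p | p.Prime ∧ ¬ p ∣ n}

/-- The canonical epimorphism `S = ℤ[J⁻¹] → ℤ/n`, where `J` is the set of primes not
dividing `n`. -/
def toZMod (n : ℕ) : ZInv (primesNot n) →+* ZMod n :=
  IsLocalization.lift (M := multSet (primesNot n)) (g := Int.castRingHom (ZMod n)) (by
    rintro ⟨y, hy⟩
    have : multSet (primesNot n) ≤ (IsUnit.submonoid (ZMod n)).comap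
        (Int.castRingHom (ZMod n)).toMonoidHom := by
      refine Submonoid.closure_le.2 ?_
      rintro _ ⟨p, ⟨hp, hpn⟩, rfl⟩
      change IsUnit (((p : ℤ)) : ZMod n)
      rw [Int.cast_natCast]
      exact (ZMod.isUnit_iff_coprime p n).2 ((Nat.Prime.coprime_iff_not_dvd hp).2 hpn)
    exact this hy)

/-! ### Completion and localization -/

/-- The ring homomorphism `Λ̂ → Λ̂'` induced by `f : Λ → Λ'` with `f(I) ⊆ I'`. -/
def completionMap {Λ Λ' : Type*} [CommRing Λ] [CommRing Λ'] (I : Ideal Λ) (I' : Ideal Λ')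
    (f : Λ →+* Λ') (hf : I ≤ I'.comap f) : AdicCompletion I Λ →+* AdicCompletion I' Λ' :=
  AdicCompletion.liftRingHom I'
    (fun n => (Ideal.quotientMap (I' ^ n) f
      ((Ideal.pow_right_mono hf n).trans (Ideal.le_comap_pow f n))).comp
        (AdicCompletion.evalₐ I n).toRingHom)
    (by
      intro m n hmn
      ext x
      obtain ⟨x, rfl⟩ := AdicCompletion.mk_surjective I Λ x
      simp only [RingHom.comp_apply, AlgHom.toRingHom_eq_coe, RingHom.coe_coe,
        AdicCompletion.evalₐ_mk, Ideal.quotientMap_mk, Ideal.Quotient.factor_mk]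
      have h := AdicCompletion.Ideal.mk_eq_mk I hmn x
      have h2 := congrArg (Ideal.quotientMap (I' ^ m) f
        ((Ideal.pow_right_mono hf m).trans (Ideal.le_comap_pow f m))) h
      simpa using h2)

/-- The multiplicative set `1 + I`. -/
def onePlus {Λ : Type*} [CommRing Λ] (I : Ideal Λ) : Submonoid Λ where
  carrier := {x | x - 1 ∈ I}
  one_mem' := by simp
  mul_mem' := fun {a b} ha hb => by
    have : a * b - 1 = a * (b - 1) + (a - 1) := by ring
    simp only [Set.mem_ofPred_eq] at *
    rw [this]
    exact I.add_mem (I.mul_mem_left _ hb) ha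

section Completion

variable {Λ : Type*} [CommRing Λ] [IsNoetherianRing Λ] (I : Ideal Λ)

theorem isAdicComplete_completion :
    IsAdicComplete (I.map (algebraMap Λ (AdicCompletion I Λ))) (AdicCompletion I Λ) :=
  (IsAdicComplete.map_algebraMap_iff _ _).2
    (AdicCompletion.isAdicComplete (IsNoetherian.noetherian I))

theorem isUnit_of_sub_one_mem {W : Type*} [CommRing W] (𝔞 : Ideal W) (h : 𝔞 ≤ Ideal.jacobson ⊥)
    {x : W} (hx : x - 1 ∈ 𝔞) : IsUnit x := by
  have := Ideal.mem_jacobson_bot.1 (h hx) 1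
  simpa using this

theorem isUnit_end_completion (M : Type*) [AddCommGroup M] [Module Λ M] (x : onePlus I) :
    IsUnit (algebraMap Λ (Module.End Λ (AdicCompletion I M)) x) := by
  have := isAdicComplete_completion I
  have hx : IsUnit (algebraMap Λ (AdicCompletion I Λ) x) := by
    refine isUnit_of_sub_one_mem _ (IsAdicComplete.le_jacobson_bot
      (I.map (algebraMap Λ (AdicCompletion I Λ)))) ?_
    rw [← map_one (algebraMap Λ (AdicCompletion I Λ)), ← map_sub]
    exact Ideal.mem_map_of_mem _ x.2
  rw [Module.End.isUnit_iff]
  obtain ⟨y, hy⟩ := hx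
  have key : ∀ z : AdicCompletion I M,
      algebraMap Λ (Module.End Λ (AdicCompletion I M)) x z = (y : AdicCompletion I Λ) • z := by
    intro z
    rw [hy, Module.algebraMap_end_apply, algebraMap_smul]
  constructor
  · intro a b hab
    rw [key, key] at hab
    exact smul_left_cancel y hab
  · intro b
    exact ⟨y⁻¹ • b, by rw [key]; exact smul_inv_smul y b⟩

/-- The canonical map `M[(1+I)⁻¹] → M̂`. -/
def locToCompletion (M : Type*) [AddCommGroup M] [Module Λ M] :
    LocalizedModule (onePlus I) M →ₗ[Λ] AdicCompletion I M :=
  LocalizedModule.lift (onePlus I) (AdicCompletion.of I M) (isUnit_end_completion I M)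

end Completion

/-! ### Actions, exterior squares, coinvariants -/

section Actions

variable {H : Type*} [Monoid H] {Λ : Type*} [CommRing Λ]

/-- The action of `H` on a `Λ`-module through a homomorphism `θ : H → Λ`. -/
def actionVia (θ : H →* Λ) (N : Type*) [AddCommGroup N] [Module Λ N] : Representation ℤ H N :=
  ((Module.toModuleEnd ℤ N : Λ →+* Module.End ℤ N) : Λ →* Module.End ℤ N).comp θ

/-- The action of `H` on an `I`-adically complete `Λ`-module `N = N̂` through a homomorphism
`θ : H → Λ̂`. -/
def actionViaCompletion {I : Ideal Λ} (θ : H →* AdicCompletion I Λ) (N : Type*) [AddCommGroup N]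
    [Module Λ N] [IsAdicComplete I N] : Representation ℤ H N where
  toFun h :=
    { toFun := fun x => (AdicCompletion.ofLinearEquiv I N).symm
        (θ h • AdicCompletion.ofLinearEquiv I N x)
      map_add' := fun x y => by rw [map_add, smul_add, map_add]
      map_smul' := fun r x => by
        rw [map_zsmul, smul_comm, map_zsmul]
        rfl }
  map_one' := by
    ext x
    simp
  map_mul' g h := by
    ext x
    simp [mul_smul]

/-- The diagonal action on the exterior square (over `ℤ`). -/
def extSq {N : Type*} [AddCommGroup N] (ρ : Representation ℤ H N) :
    Representation ℤ H (⋀[ℤ]^2 N) where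
  toFun h := exteriorPower.map 2 (ρ h)
  map_one' := by
    rw [map_one]
    exact exteriorPower.map_id (R := ℤ) (n := 2) (M := N)
  map_mul' g h := by
    rw [map_mul]
    exact exteriorPower.map_comp (ρ h) (ρ g)

/-- The class of `x ∧ y` in the coinvariants `(∧² N)_H`. -/
def wedgeClass {N : Type*} [AddCommGroup N] (ρ : Representation ℤ H N) (x y : N) :
    (extSq ρ).Coinvariants :=
  Representation.Coinvariants.mk (extSq ρ) (exteriorPower.ιMulti ℤ 2 ![x, y])

/-- The map `f : N → N'` induces an isomorphism `(∧² N)_H ≅ (∧² N')_{H'}`,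
`x ∧ y ↦ f x ∧ f y`. -/
def InducesIso {H' : Type*} [Monoid H'] {N N' : Type*} [AddCommGroup N] [AddCommGroup N']
    (ρ : Representation ℤ H N) (ρ' : Representation ℤ H' N') (f : N → N') : Prop :=
  ∃ e : (extSq ρ).Coinvariants ≃+ (extSq ρ').Coinvariants,
    ∀ x y, e (wedgeClass ρ x y) = wedgeClass ρ' (f x) (f y)

end Actions

/-! ### Nilpotency -/

section Nilpotent

variable {k A : Type*} [CommRing k] [CommGroup A]

theorem of_sub_one_mem_augIdeal (a : A) : MonoidAlgebra.of k A a - 1 ∈ augIdeal k A := by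
  simp [augIdeal, augmentation, RingHom.mem_ker]

theorem augIdeal_eq_span :
    augIdeal k A = Ideal.span (Set.range fun a : A => MonoidAlgebra.of k A a - 1) := by
  apply le_antisymm
  · have key : ∀ x : MonoidAlgebra k A, x - algebraMap k _ (augmentation k A x) ∈
        Ideal.span (Set.range fun a : A => MonoidAlgebra.of k A a - 1) := by
      intro x
      induction x using MonoidAlgebra.induction_on with
      | of a =>
        have : augmentation k A (MonoidAlgebra.of k A a) = 1 := by simp [augmentation]
        rw [this, map_one]
        exact Ideal.subset_span ⟨a, rfl⟩
      | add x y hx hy =>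
        rw [map_add, map_add, add_sub_add_comm]
        exact Ideal.add_mem _ hx hy
      | smul r x hx =>
        have : augmentation k A (r • x) = r * augmentation k A x := by simp [augmentation]
        rw [this, map_mul, Algebra.smul_def, ← mul_sub]
        exact Ideal.mul_mem_left _ _ hx
    intro x hx
    have h := key x
    rw [augIdeal, RingHom.mem_ker] at hx
    rwa [hx, map_zero, sub_zero] at h
  · rw [Ideal.span_le]
    rintro _ ⟨a, rfl⟩
    exact of_sub_one_mem_augIdeal a

theorem pow_augIdeal_smul_le {N : Type*} [AddCommGroup N] [Module (MonoidAlgebra k A) N]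
    (F : ℕ → Submodule (MonoidAlgebra k A) N) (h0 : F 0 = ⊤)
    (hF : ∀ j a, ∀ x ∈ F j, (MonoidAlgebra.of k A a - 1) • x ∈ F (j + 1)) (j : ℕ) :
    (augIdeal k A ^ j • ⊤ : Submodule (MonoidAlgebra k A) N) ≤ F j := by
  induction j with
  | zero => simp [h0]
  | succ j ih =>
    rw [pow_succ', Submodule.mul_smul]
    refine (Submodule.smul_mono le_rfl ih).trans ?_
    rw [augIdeal_eq_span, Submodule.smul_le]
    intro r hr x hx
    induction hr using Submodule.span_induction with
    | mem r hr =>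
      obtain ⟨a, rfl⟩ := hr
      exact hF j a x hx
    | zero =>
      rw [zero_smul]
      exact Submodule.zero_mem _
    | add r s _ _ hr hs =>
      rw [add_smul]
      exact Submodule.add_mem _ hr hs
    | smul c r _ hr =>
      rw [smul_eq_mul, mul_smul]
      exact Submodule.smul_mem _ _ hr

theorem isAdicComplete_of_nilpotent {Λ : Type*} [CommRing Λ] (I : Ideal Λ) (N : Type*)
    [AddCommGroup N] [Module Λ N] (m : ℕ) (h : (I ^ m • ⊤ : Submodule Λ N) = ⊥) :
    IsAdicComplete I N where
  haus' x hx := by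
    have := hx m
    rwa [h, SModEq.bot] at this
  prec' f hf := by
    refine ⟨f m, fun n => ?_⟩
    rcases le_total n m with hnm | hnm
    · exact hf hnm
    · have := hf hnm
      rw [h, SModEq.bot] at this
      rw [this]

end Nilpotent

/-! ### The homomorphisms `θ_R` -/

section ThetaZ

/-- The group `1 + 𝔞` of units of `W` that are congruent to `1` modulo `𝔞`. -/
abbrev principalUnits {W : Type*} [CommRing W] (𝔞 : Ideal W) : Subgroup Wˣ :=
  (Units.map (Ideal.Quotient.mk 𝔞).toMonoidHom).ker

theorem mem_principalUnits {W : Type*} [CommRing W] (𝔞 : Ideal W) (x : Wˣ) :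
    x ∈ principalUnits 𝔞 ↔ (x : W) - 1 ∈ 𝔞 := by
  rw [MonoidHom.mem_ker, Units.ext_iff, ← Ideal.Quotient.eq]
  simp

/-- In a complete ring in which `p` is invertible, the group `1 + 𝔞` is uniquely
`p`-divisible. -/
theorem pow_bijective_principalUnits {W : Type*} [CommRing W] (𝔞 : Ideal W) [IsAdicComplete 𝔞 W]
    (p : ℕ) (hp : IsUnit (p : W)) :
    Function.Bijective fun x : principalUnits 𝔞 => x ^ p := by
  have hjac := IsAdicComplete.le_jacobson_bot 𝔞
  rcases eq_or_ne p 0 with rfl | hp0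
  · have : Subsingleton W := by
      rw [Nat.cast_zero, isUnit_zero_iff] at hp
      exact subsingleton_of_zero_eq_one hp
    exact ⟨fun a b _ => Subsingleton.elim _ _, fun b => ⟨b, Subsingleton.elim _ _⟩⟩
  constructor
  · have h1 : ∀ x : principalUnits 𝔞, x ^ p = 1 → x = 1 := by
      intro x hx
      have hx1 : ((x : Wˣ) : W) - 1 ∈ 𝔞 := (mem_principalUnits 𝔞 _).1 x.2
      have hxp : ((x : Wˣ) : W) ^ p = 1 := by
        have := congrArg (fun y : principalUnits 𝔞 => ((y : Wˣ) : W)) hx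
        simpa using this
      set y : W := ((x : Wˣ) : W)
      have hmul : (∑ i ∈ Finset.range p, y ^ i) * (y - 1) = 0 := by
        rw [geom_sum_mul, hxp, sub_self]
      have hsum : (∑ i ∈ Finset.range p, y ^ i) - p ∈ 𝔞 := by
        have : (∑ i ∈ Finset.range p, y ^ i) - p = ∑ i ∈ Finset.range p, (y ^ i - 1) := by
          rw [Finset.sum_sub_distrib]
          simp
        rw [this]
        refine Ideal.sum_mem _ fun i _ => ?_
        exact Ideal.mem_of_dvd _ (sub_one_dvd_pow_sub_one y i) hx1
      obtain ⟨q, hq⟩ := hp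
      have hu : IsUnit (∑ i ∈ Finset.range p, y ^ i) := by
        have h2 : IsUnit (((q⁻¹ : Wˣ) : W) * ∑ i ∈ Finset.range p, y ^ i) := by
          refine isUnit_of_sub_one_mem 𝔞 hjac ?_
          have : ((q⁻¹ : Wˣ) : W) * (∑ i ∈ Finset.range p, y ^ i) - 1 =
              ((q⁻¹ : Wˣ) : W) * ((∑ i ∈ Finset.range p, y ^ i) - p) := by
            rw [mul_sub, ← hq, Units.inv_mul]
          rw [this]
          exact Ideal.mul_mem_left _ _ hsum
        exact (Units.isUnit_units_mul _ _).1 h2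
      have hy : y - 1 = 0 := (hu.mul_right_eq_zero).1 hmul
      apply Subtype.ext
      apply Units.ext
      exact sub_eq_zero.1 hy
    intro a b hab
    have := h1 (a / b) (by
      have hab' : a ^ p = b ^ p := hab
      rw [div_pow, hab', div_self'])
    exact div_eq_one.1 this
  · intro x
    have hx1 : ((x : Wˣ) : W) - 1 ∈ 𝔞 := (mem_principalUnits 𝔞 _).1 x.2
    obtain ⟨y, hy, hy1⟩ := HenselianRing.is_henselian (I := 𝔞)
      (Polynomial.X ^ p - Polynomial.C ((x : Wˣ) : W))
      (Polynomial.monic_X_pow_sub_C _ hp0) 1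
      (by
        have := 𝔞.neg_mem hx1
        simpa using this)
      (by
        have := hp.map (Ideal.Quotient.mk 𝔞)
        simpa [Polynomial.derivative_X_pow] using this)
    have hyu := isUnit_of_sub_one_mem 𝔞 hjac hy1
    refine ⟨⟨hyu.unit, (mem_principalUnits 𝔞 _).2 hy1⟩, ?_⟩
    apply Subtype.ext
    apply Units.ext
    have : y ^ p - ((x : Wˣ) : W) = 0 := by simpa [Polynomial.IsRoot] using hy
    simpa using sub_eq_zero.1 this

variable (J : Set ℕ) (A : Type u) [CommGroup A]

instance [Group.FG A] (k : Type*) [CommRing k] [IsNoetherianRing k] :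
    IsNoetherianRing (MonoidAlgebra k A) :=
  haveI : Monoid.FG A := Group.fg_iff_monoid_fg.1 inferInstance
  Algebra.FiniteType.isNoetherianRing k _

/-- The completed group ring `R[A]^` for `R = ℤ[J⁻¹]`, with respect to the augmentation ideal. -/
abbrev complZ : Type u := AdicCompletion (augIdeal (ZInv J) A) (MonoidAlgebra (ZInv J) A)

/-- The ideal `Î_R` of the completed group ring. -/
abbrev complZIdeal : Ideal (complZ J A) :=
  (augIdeal (ZInv J) A).map (algebraMap (MonoidAlgebra (ZInv J) A) (complZ J A))

variable [Group.FG A]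

/-- The canonical homomorphism `A → 1 + Î_R`. -/
def toPrincipalUnits : A →* principalUnits (complZIdeal J A) :=
  MonoidHom.codRestrict
    ((Units.map (algebraMap (MonoidAlgebra (ZInv J) A) (complZ J A)).toMonoidHom).comp
      (MonoidHom.toHomUnits (MonoidAlgebra.of (ZInv J) A))) _ (by
    intro a
    rw [mem_principalUnits]
    change algebraMap (MonoidAlgebra (ZInv J) A) (complZ J A) (MonoidAlgebra.of (ZInv J) A a) - 1
      ∈ complZIdeal J A
    rw [← map_one (algebraMap (MonoidAlgebra (ZInv J) A) (complZ J A)), ← map_sub]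
    exact Ideal.mem_map_of_mem _ (of_sub_one_mem_augIdeal a))

theorem isUnit_end_principalUnits (s : multSet J) :
    IsUnit (algebraMap ℤ (Module.End ℤ (Additive (principalUnits (complZIdeal J A)))) s) := by
  have := isAdicComplete_completion (augIdeal (ZInv J) A)
  have hle : multSet J ≤ (IsUnit.submonoid
      (Module.End ℤ (Additive (principalUnits (complZIdeal J A))))).comap
      (algebraMap ℤ (Module.End ℤ (Additive (principalUnits (complZIdeal J A))))).toMonoidHom := by
    refine Submonoid.closure_le.2 ?_
    rintro _ ⟨p, hp, rfl⟩
    change IsUnit (algebraMap ℤ _ (p : ℤ))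
    rw [Module.End.isUnit_iff]
    have hu : IsUnit ((p : ℕ) : complZ J A) := by
      have h1 : IsUnit (algebraMap ℤ (ZInv J) (p : ℤ)) :=
        IsLocalization.map_units (ZInv J) (⟨(p : ℤ), Submonoid.subset_closure ⟨p, hp, rfl⟩⟩ : multSet J)
      rw [eq_intCast, Int.cast_natCast] at h1
      have h2 := (h1.map (algebraMap (ZInv J) (MonoidAlgebra (ZInv J) A))).map
        (algebraMap (MonoidAlgebra (ZInv J) A) (complZ J A))
      rwa [map_natCast, map_natCast] at h2
    have hb := pow_bijective_principalUnits (complZIdeal J A) p hu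
    have he : ∀ x : Additive (principalUnits (complZIdeal J A)),
        algebraMap ℤ (Module.End ℤ (Additive (principalUnits (complZIdeal J A)))) (p : ℤ) x =
          Additive.ofMul (x.toMul ^ p) := by
      intro x
      rw [Module.algebraMap_end_apply, natCast_zsmul]
      rfl
    constructor
    · intro x y hxy
      rw [he, he] at hxy
      exact hb.1 hxy
    · intro y
      obtain ⟨x, hx⟩ := hb.2 y.toMul
      exact ⟨Additive.ofMul x, (he _).trans (congrArg Additive.ofMul hx)⟩
  exact hle s.2

/-- The homomorphism `A ⊗ R → 1 + Î_R` for `R = ℤ[J⁻¹]`: the unique one that extends the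
canonical homomorphism `A → 1 + Î_R` (whose target is uniquely `J`-divisible). -/
def thetaTilde : ZInv J ⊗[ℤ] Additive A →ₗ[ℤ] Additive (principalUnits (complZIdeal J A)) :=
  IsLocalizedModule.lift (multSet J) (TensorProduct.mk ℤ (ZInv J) (Additive A) 1)
    (MonoidHom.toAdditive (toPrincipalUnits J A)).toIntLinearMap (isUnit_end_principalUnits J A)

/-- The homomorphism `θ_R : A ⊗ R → R[A]^` for `R = ℤ[J⁻¹]`. -/
def thetaZ : Multiplicative (ZInv J ⊗[ℤ] Additive A) →* complZ J A :=
  (Units.coeHom (complZ J A)).comp ((principalUnits (complZIdeal J A)).subtype.comp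
    (AddMonoidHom.toMultiplicativeLeft (thetaTilde J A).toAddMonoidHom))

end ThetaZ

section ThetaMod

variable (n : ℕ) (A : Type u) [CommGroup A]

/-- The subgroup `A^k` of `k`-th powers. -/
abbrev powers (k : ℕ) : Subgroup A := (powMonoidHom k : A →* A).range

theorem powers_succ_le (i : ℕ) : powers A (n ^ (i + 1)) ≤ powers A (n ^ i) := by
  rintro _ ⟨a, rfl⟩
  exact ⟨a ^ n, by simp [← pow_mul, pow_succ']⟩

/-- The projection `A / A^{n^(i+1)} → A / A^{n^i}`. -/
abbrev powProj (i : ℕ) : A ⧸ powers A (n ^ (i + 1)) →* A ⧸ powers A (n ^ i) :=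
  QuotientGroup.map _ _ (MonoidHom.id A) (powers_succ_le n A i)

/-- The group `Â_n`, the inverse limit of the groups `A / A^{n^i}`. -/
def hatMod : Subgroup (∀ i : ℕ, A ⧸ powers A (n ^ i)) where
  carrier := {x | ∀ i, powProj n A i (x (i + 1)) = x i}
  one_mem' := fun i => map_one _
  mul_mem' := fun {x y} hx hy i => by
    rw [Pi.mul_apply, map_mul, hx i, hy i, Pi.mul_apply]
  inv_mem' := fun {x} hx i => by
    rw [Pi.inv_apply, map_inv, hx i, Pi.inv_apply]

/-- If `x ≡ 1` modulo `I` and `n ∈ I`, then `x^(n^i) ≡ 1` modulo `I^i`. -/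
theorem pow_sub_one_mem {Λ : Type*} [CommRing Λ] (I : Ideal Λ) (hn : (n : Λ) ∈ I) {x : Λ}
    (hx : x - 1 ∈ I) (i : ℕ) : x ^ n ^ i - 1 ∈ I ^ i := by
  have key : ∀ i, x ^ n ^ i - 1 ∈ I ^ (i + 1) := by
    intro i
    induction i with
    | zero => simpa using hx
    | succ i ih =>
      set y := x ^ n ^ i
      have hy : y - 1 ∈ I := Ideal.pow_le_self (Nat.succ_ne_zero i) ih
      rw [pow_succ n, pow_mul, ← geom_sum_mul, pow_succ', ← pow_succ' I]
      rw [pow_succ' I (i + 1)]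
      refine Ideal.mul_mem_mul ?_ ih
      have : (∑ j ∈ Finset.range n, y ^ j) = ∑ j ∈ Finset.range n, (y ^ j - 1) + n := by
        rw [Finset.sum_sub_distrib]
        simp
      rw [this]
      exact I.add_mem (Ideal.sum_mem _ fun j _ =>
        Ideal.mem_of_dvd _ (sub_one_dvd_pow_sub_one y j) hy) hn
  exact Ideal.pow_le_pow_right (Nat.le_succ i) (key i)

/-- `S = ℤ[J⁻¹]`, where `J` is the set of primes not dividing `n`. -/
abbrev SMod : Type := ZInv (primesNot n)

/-- The ideal `𝓘_S`, the kernel of `S[A] → ℤ/n`. -/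
def idealS : Ideal (MonoidAlgebra (SMod n) A) :=
  RingHom.ker ((toZMod n).comp (augmentation (SMod n) A))

theorem natCast_mem_idealS : ((n : ℕ) : MonoidAlgebra (SMod n) A) ∈ idealS n A := by
  simp [idealS, RingHom.mem_ker]

theorem augIdeal_le_idealS : augIdeal (SMod n) A ≤ idealS n A := by
  intro x hx
  rw [augIdeal, RingHom.mem_ker] at hx
  rw [idealS, RingHom.mem_ker, RingHom.comp_apply, hx, map_zero]

/-- The homomorphism `A / A^{n^i} → S[A] / 𝓘_S^i` induced by `A → S[A]`. -/
def thetaModLevel (i : ℕ) : A ⧸ powers A (n ^ i) →*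
    MonoidAlgebra (SMod n) A ⧸ (idealS n A ^ i • ⊤ : Ideal (MonoidAlgebra (SMod n) A)) :=
  QuotientGroup.lift _ ((Ideal.Quotient.mk _).toMonoidHom.comp (MonoidAlgebra.of (SMod n) A)) (by
    rintro _ ⟨a, rfl⟩
    change Ideal.Quotient.mk _ (MonoidAlgebra.of (SMod n) A (a ^ n ^ i)) = 1
    rw [← map_one (Ideal.Quotient.mk _), Ideal.Quotient.eq, map_pow, smul_eq_mul, Ideal.mul_top]
    exact pow_sub_one_mem n _ (natCast_mem_idealS n A)
      (augIdeal_le_idealS n A (of_sub_one_mem_augIdeal a)) i)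

/-- The completed group ring `S[A]^` with respect to `𝓘_S`. -/
abbrev complMod : Type u := AdicCompletion (idealS n A) (MonoidAlgebra (SMod n) A)

theorem thetaModLevel_compat (i : ℕ) (x : A ⧸ powers A (n ^ (i + 1))) :
    AdicCompletion.transitionMap (idealS n A) (MonoidAlgebra (SMod n) A) (Nat.le_succ i)
      (thetaModLevel n A (i + 1) x) = thetaModLevel n A i (powProj n A i x) := by
  obtain ⟨a, rfl⟩ := QuotientGroup.mk_surjective x
  rfl

/-- The homomorphism `θ_R : Â_n → S[A]^` for `R = ℤ/n`. -/
def thetaMod : hatMod n A →* complMod n A where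
  toFun x := ⟨fun i => thetaModLevel n A i (x.1 i), by
    intro i j hij
    induction j, hij using Nat.le_induction with
    | base => simp
    | succ j hij ih =>
      rw [← ih]
      change _ = AdicCompletion.transitionMap (idealS n A) (MonoidAlgebra (SMod n) A) hij
        (thetaModLevel n A j (x.1 j))
      rw [← x.2 j, ← thetaModLevel_compat]
      exact (Submodule.factor_comp_apply _ _ _).symm⟩
  map_one' := by
    apply AdicCompletion.ext
    intro i
    exact map_one (thetaModLevel n A i)
  map_mul' x y := by
    apply AdicCompletion.ext
    intro i
    exact map_mul (thetaModLevel n A i) _ _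

end ThetaMod

/-! ### The modules of the theorem -/

section Objects

variable (A : Type u) [CommGroup A] (M : Type v) [AddCommGroup M] [Module (MonoidAlgebra ℤ A) M]
  (K : Type z) [CommRing K]

/-- `M_K = M ⊗ K`, a `K[A]`-module. -/
abbrev MK : Type (max u v z) := ExtendScalars (grMap A (Int.castRingHom K)) M

/-- The completion `M̂_K` with respect to the augmentation ideal `I_K`. -/
abbrev hatMK : Type (max u v z) := AdicCompletion (augIdeal K A) (MK A M K)

/-- The localization `M_K[(1 + I_K)⁻¹]`. -/
abbrev locMK : Type (max u v z) := LocalizedModule (onePlus (augIdeal K A)) (MK A M K)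

/-- The truncation `M_K / M_K I_K^m`. -/
abbrev truncMK (m : ℕ) : Type (max u v z) :=
  MK A M K ⧸ (augIdeal K A ^ m • ⊤ : Submodule (MonoidAlgebra K A) (MK A M K))

/-- The action of `A` on a `K[A]`-module. -/
abbrev actA (N : Type*) [AddCommGroup N] [Module (MonoidAlgebra K A) N] : Representation ℤ A N :=
  actionVia (MonoidAlgebra.of K A) N

end Objects

theorem augIdeal_le_comap (A : Type*) [CommGroup A] {k k' : Type*} [CommRing k] [CommRing k']
    (f : k →+* k') : augIdeal k A ≤ (augIdeal k' A).comap (grMap A f) := by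
  rw [augIdeal_eq_span, Ideal.span_le]
  rintro _ ⟨a, rfl⟩
  have h := of_sub_one_mem_augIdeal (k := k') a
  simpa [MonoidAlgebra.of_apply] using h

theorem augmentation_grMap (A : Type*) [CommGroup A] {k k' : Type*} [CommRing k] [CommRing k']
    (f : k →+* k') (x : MonoidAlgebra k A) :
    augmentation k' A (grMap A f x) = f (augmentation k A x) := by
  induction x using MonoidAlgebra.induction_linear with
  | zero => simp
  | add x y hx hy => rw [map_add, map_add, map_add, map_add, hx, hy]
  | single a r => simp [augmentation]

section CaseZ

variable (R : Type) [CommRing R] {A : Type u} [CommGroup A] {M : Type v} [AddCommGroup M]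
  [Module (MonoidAlgebra ℤ A) M] {G : Type w} [Group G] (D : Decomposition A M G)
  (K : Type z) [CommRing K] [Algebra R K]

/-- The submodule `γ_m(G) ⊗ R` (meaning `(γ_m(G) ∩ M) ⊗ R`) of `M ⊗ R`. -/
def gammaTensor (m : ℕ) : Submodule (MonoidAlgebra R A)
    (ExtendScalars (grMap A (Int.castRingHom R)) M) :=
  Submodule.span _ (ExtendScalars.unit (grMap A (Int.castRingHom R)) M ''
    (D.inter (gammaZ G m)))

/-- The module `𝓜^m = (M ⊗ R) / (γ_m(G) ⊗ R)` in the case `R = ℤ[J⁻¹]`. -/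
abbrev calZ (m : ℕ) : Type (max u v) :=
  ExtendScalars (grMap A (Int.castRingHom R)) M ⧸ gammaTensor R D m

/-- The module `𝓜^m_K = 𝓜^m ⊗ K` in the case `R = ℤ[J⁻¹]`. -/
abbrev calKZ (m : ℕ) : Type (max u v z) :=
  ExtendScalars (grMap A (algebraMap R K)) (calZ R D m)

/-- The map `M → 𝓜^m_K`. -/
def toCalKZ (m : ℕ) : M →ₛₗ[grMap A (Int.castRingHom K)] calKZ R D K m where
  toFun x := ExtendScalars.unit _ _ ((gammaTensor R D m).mkQ (ExtendScalars.unit _ _ x))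
  map_add' x y := by rw [map_add, map_add, map_add]
  map_smul' r x := by
    rw [map_smulₛₗ, map_smul, map_smulₛₗ, ← RingHom.comp_apply, ← MonoidAlgebra.mapRingHom_comp,
      RingHom.ext_int ((algebraMap R K).comp (Int.castRingHom R))
        (Int.castRingHom K)]

/-- The canonical epimorphism `M_K → 𝓜^m_K`. -/
def projKZ (m : ℕ) : MK A M K →ₗ[MonoidAlgebra K A] calKZ R D K m :=
  ExtendScalars.lift _ (toCalKZ R D K m)

theorem toCalKZ_eq_zero (m : ℕ) (x : M) (hx : x ∈ D.inter (gammaZ G m)) :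
    toCalKZ R D K m x = 0 := by
  change ExtendScalars.unit _ _ ((gammaTensor R D m).mkQ (ExtendScalars.unit _ _ x)) = 0
  have : (gammaTensor R D m).mkQ (ExtendScalars.unit _ _ x) = 0 := by
    rw [Submodule.mkQ_apply, Submodule.Quotient.mk_eq_zero]
    exact Submodule.subset_span ⟨x, hx, rfl⟩
  rw [this, map_zero]

theorem span_range_toCalKZ (m : ℕ) :
    Submodule.span (MonoidAlgebra K A) (Set.range (toCalKZ R D K m)) = ⊤ := by
  rw [eq_top_iff, ← ExtendScalars.span_range_unit, Submodule.span_le]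
  rintro _ ⟨y, rfl⟩
  obtain ⟨y, rfl⟩ := (gammaTensor R D m).mkQ_surjective y
  have hy : y ∈ Submodule.span (MonoidAlgebra R A)
      (Set.range (ExtendScalars.unit (grMap A (Int.castRingHom R)) M)) := by
    rw [ExtendScalars.span_range_unit]
    exact Submodule.mem_top
  induction hy using Submodule.span_induction with
  | mem y hy =>
    obtain ⟨x, rfl⟩ := hy
    exact Submodule.subset_span ⟨x, rfl⟩
  | zero =>
    rw [map_zero, map_zero]
    exact Submodule.zero_mem _
  | add y z _ _ hy hz =>
    rw [map_add, map_add]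
    exact Submodule.add_mem _ hy hz
  | smul r y _ hy =>
    rw [map_smul, map_smulₛₗ]
    exact Submodule.smul_mem _ _ hy

end CaseZ

section Kill

variable {A : Type u} [CommGroup A] {M : Type v} [AddCommGroup M]
  [Module (MonoidAlgebra ℤ A) M] {G : Type w} [Group G] (D : Decomposition A M G)
  (K : Type z) [CommRing K] {N : Type*} [AddCommGroup N] [Module (MonoidAlgebra K A) N]

/-- A quotient of `M_K` in which `γ_m(G) ∩ M` dies is annihilated by `I_K^m`, for every
descending series `γ` of normal subgroups with `γ 0 = G` and `[γ j, G] ≤ γ (j+1)`. -/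
theorem pow_augIdeal_smul_eq_bot (g : M →ₛₗ[grMap A (Int.castRingHom K)] N)
    (hg : Submodule.span (MonoidAlgebra K A) (Set.range g) = ⊤)
    (γ : ℕ → Subgroup G) (hn : ∀ i, (γ i).Normal) (h0 : γ 0 = ⊤)
    (hγ : ∀ j, ⁅γ j, (⊤ : Subgroup G)⁆ ≤ γ (j + 1)) (m : ℕ)
    (hm : ∀ x ∈ D.inter (γ (m - 1)), g x = 0) :
    (augIdeal K A ^ m • ⊤ : Submodule (MonoidAlgebra K A) N) = ⊥ := by
  have key := pow_augIdeal_smul_le (k := K) (A := A) (N := N)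
    (fun j => Submodule.span _ (g '' (D.inter (γ j))))
    (by
      have : (D.inter (γ 0) : Set M) = Set.univ := by
        ext x
        simp only [Set.mem_univ, iff_true]
        change D.ι (Multiplicative.ofAdd x) ∈ γ 0
        rw [h0]
        exact Subgroup.mem_top _
      rw [this, Set.image_univ, hg])
    (by
      intro j a x hx
      induction hx using Submodule.span_induction with
      | mem y hy =>
        obtain ⟨x, hx, rfl⟩ := hy
        refine Submodule.subset_span ⟨(MonoidAlgebra.of ℤ A a - 1) • x,
          D.sub_one_smul_mem (γ j) (γ (j + 1)) (hγ j) a hx, ?_⟩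
        rw [map_smulₛₗ]
        congr 1
        simp [MonoidAlgebra.of_apply]
      | zero =>
        rw [smul_zero]
        exact Submodule.zero_mem _
      | add y z _ _ hy hz =>
        rw [smul_add]
        exact Submodule.add_mem _ hy hz
      | smul r y _ hy =>
        rw [smul_comm]
        exact Submodule.smul_mem _ _ hy) (m - 1)
  rw [eq_bot_iff]
  refine (Submodule.smul_mono (Ideal.pow_le_pow_right (Nat.sub_le m 1)) le_rfl).trans
    (key.trans ?_)
  rw [Submodule.span_le]
  rintro _ ⟨x, hx, rfl⟩
  exact hm x hx

end Kill

section NilpotentZ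

variable (R : Type) [CommRing R] {A : Type u} [CommGroup A] {M : Type v} [AddCommGroup M]
  [Module (MonoidAlgebra ℤ A) M] {G : Type w} [Group G] (D : Decomposition A M G)
  (K : Type z) [CommRing K] [Algebra R K]

theorem pow_smul_calKZ (m : ℕ) :
    (augIdeal K A ^ m • ⊤ : Submodule (MonoidAlgebra K A) (calKZ R D K m)) = ⊥ :=
  pow_augIdeal_smul_eq_bot D K (toCalKZ R D K m) (span_range_toCalKZ R D K m)
    (fun i => (⊤ : Subgroup G).lowerCentralSeries i) (fun _ => inferInstance) rfl
    (fun _ => le_rfl) m (fun x hx => toCalKZ_eq_zero R D K m x hx)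

instance (m : ℕ) : IsAdicComplete (augIdeal K A) (calKZ R D K m) :=
  isAdicComplete_of_nilpotent _ _ m (pow_smul_calKZ R D K m)

/-- The map `M_K / M_K I_K^m → 𝓜^m_K` in the case `R = ℤ[J⁻¹]`. -/
def truncToCalKZ (m : ℕ) : truncMK A M K m →ₗ[MonoidAlgebra K A] calKZ R D K m :=
  Submodule.liftQ _ (projKZ R D K m) (by
    rw [LinearMap.le_ker_iff_map, ← le_bot_iff, Submodule.map_smul'']
    refine (Submodule.smul_mono le_rfl le_top).trans ?_
    rw [pow_smul_calKZ])

end NilpotentZ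

section ActionZ

variable (J : Set ℕ) {A : Type u} [CommGroup A] [Group.FG A] {M : Type v} [AddCommGroup M]
  [Module (MonoidAlgebra ℤ A) M] {G : Type w} [Group G] (D : Decomposition A M G)
  (K : Type z) [CommRing K] [Algebra (ZInv J) K]

/-- The homomorphism `A ⊗ R → R[A]^ → K[A]^`, for `R = ℤ[J⁻¹]`. -/
def thetaKZ : Multiplicative (ZInv J ⊗[ℤ] Additive A) →*
    AdicCompletion (augIdeal K A) (MonoidAlgebra K A) :=
  (completionMap (augIdeal (ZInv J) A) (augIdeal K A) (grMap A (algebraMap (ZInv J) K))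
    (augIdeal_le_comap A _)).toMonoidHom.comp (thetaZ J A)

/-- The action of `Â_R = A ⊗ R` on `M̂_K`, for `R = ℤ[J⁻¹]`. -/
def hatActionZ (M : Type v) [AddCommGroup M] [Module (MonoidAlgebra ℤ A) M] :
    Representation ℤ (Multiplicative (ZInv J ⊗[ℤ] Additive A)) (hatMK A M K) :=
  actionVia (thetaKZ J K) (hatMK A M K)

/-- The action of `t_m^R(A) = A ⊗ R` on the nilpotent (hence complete) `K[A]`-module `𝓜^m_K`
through `θ_R`, for `R = ℤ[J⁻¹]`. It extends the action of `A`, and is the action by conjugation in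
the Malcev completion of `G / γ_m(G)`. -/
def calActionZ (m : ℕ) :
    Representation ℤ (Multiplicative (ZInv J ⊗[ℤ] Additive A)) (calKZ (ZInv J) D K m) :=
  actionViaCompletion (thetaKZ J K) (calKZ (ZInv J) D K m)

end ActionZ

section CaseMod

variable (n : ℕ) {A : Type u} [CommGroup A] {M : Type v} [AddCommGroup M]
  [Module (MonoidAlgebra ℤ A) M] {G : Type w} [Group G] (D : Decomposition A M G)
  (K : Type z) [CommRing K]

/-- The homomorphism `Â_n → S[A]^ → K[A]^`, for `R = ℤ/n`. -/
def thetaKMod [Algebra (ZMod n) K] : hatMod n A →*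
    AdicCompletion (augIdeal K A) (MonoidAlgebra K A) :=
  (completionMap (idealS n A) (augIdeal K A)
    (grMap A ((algebraMap (ZMod n) K).comp (toZMod n))) (by
      intro x hx
      rw [idealS, RingHom.mem_ker, RingHom.comp_apply] at hx
      rw [Ideal.mem_comap, augIdeal, RingHom.mem_ker, augmentation_grMap, RingHom.comp_apply, hx,
        map_zero])).toMonoidHom.comp (thetaMod n A)

/-- The module `𝓜^m = M / (γ_m(G) ∩ M)`, for `R = ℤ/n` and the `n`-lower central series. -/
abbrev calMod (m : ℕ) : Type v := M ⧸ D.inter (gammaMod n G m)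

/-- The module `𝓜^m_K = 𝓜^m ⊗ K`, for `R = ℤ/n`. -/
abbrev calKMod (m : ℕ) : Type (max u v z) :=
  ExtendScalars (grMap A (Int.castRingHom K)) (calMod n D m)

/-- The map `M → 𝓜^m_K`. -/
def toCalKMod (m : ℕ) : M →ₛₗ[grMap A (Int.castRingHom K)] calKMod n D K m :=
  (ExtendScalars.unit _ _).comp (D.inter (gammaMod n G m)).mkQ

/-- The canonical epimorphism `M_K → 𝓜^m_K`. -/
def projKMod (m : ℕ) : MK A M K →ₗ[MonoidAlgebra K A] calKMod n D K m :=
  ExtendScalars.lift _ (toCalKMod n D K m)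

theorem pow_smul_calKMod (m : ℕ) :
    (augIdeal K A ^ m • ⊤ : Submodule (MonoidAlgebra K A) (calKMod n D K m)) = ⊥ := by
  refine pow_augIdeal_smul_eq_bot D K (toCalKMod n D K m) ?_ (gammaModAux n G)
    (gammaModAux_normal n G) rfl (fun _ => le_sup_right) m ?_
  · rw [eq_top_iff, ← ExtendScalars.span_range_unit]
    refine Submodule.span_mono ?_
    rintro _ ⟨y, rfl⟩
    obtain ⟨x, rfl⟩ := (D.inter (gammaMod n G m)).mkQ_surjective y
    exact ⟨x, rfl⟩
  · intro x hx
    change ExtendScalars.unit _ _ ((D.inter (gammaMod n G m)).mkQ x) = 0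
    have h : (D.inter (gammaMod n G m)).mkQ x = 0 := by
      rw [Submodule.mkQ_apply, Submodule.Quotient.mk_eq_zero]
      exact hx
    rw [h, map_zero]

/-- The map `M_K / M_K I_K^m → 𝓜^m_K` for `R = ℤ/n`. -/
def truncToCalKMod (m : ℕ) : truncMK A M K m →ₗ[MonoidAlgebra K A] calKMod n D K m :=
  Submodule.liftQ _ (projKMod n D K m) (by
    rw [LinearMap.le_ker_iff_map, ← le_bot_iff, Submodule.map_smul'']
    refine (Submodule.smul_mono le_rfl le_top).trans ?_
    rw [pow_smul_calKMod])

variable [Algebra (ZMod n) K]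

/-- The action of `Â_R = Â_n` on `M̂_K`, for `R = ℤ/n`. -/
def hatActionMod (M : Type v) [AddCommGroup M] [Module (MonoidAlgebra ℤ A) M] :
    Representation ℤ (hatMod n A) (hatMK A M K) :=
  actionVia (thetaKMod n K) (hatMK A M K)

/-- The action of `t_m^R(A) = A / A^{n^m}` on `𝓜^m_K` induced by that of `A`, for `R = ℤ/n`. -/
def calActionMod (m : ℕ) : Representation ℤ (A ⧸ powers A (n ^ m)) (calKMod n D K m) :=
  QuotientGroup.lift (powers A (n ^ m)) (actA A K (calKMod n D K m)) (by
    rintro _ ⟨a, rfl⟩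
    have h0 : ((n : ℕ) : MonoidAlgebra K A) ∈ augIdeal K A := by
      have h1 : ((n : ℕ) : K) = 0 := by
        rw [← map_natCast (algebraMap (ZMod n) K), ZMod.natCast_self, map_zero]
      rw [augIdeal, RingHom.mem_ker, map_natCast, h1]
    have h1 := pow_sub_one_mem n (augIdeal K A) h0 (of_sub_one_mem_augIdeal a) m
    ext x
    have h2 := Submodule.smul_mem_smul h1 (Submodule.mem_top (x := x))
    rw [pow_smul_calKMod, Submodule.mem_bot, sub_smul, one_smul, sub_eq_zero] at h2
    change MonoidAlgebra.of K A (a ^ n ^ m) • x = x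
    rw [map_pow]
    exact h2)

end CaseMod

end Metabelian

end

open Metabelian

noncomputable section

namespace Metabelian

/-! ### Coinvariants of exterior squares -/

section Wedge

variable {H : Type*} [Monoid H] {N : Type*} [AddCommGroup N] (ρ : Representation ℤ H N)

/-! Write `c*` for the image of `c` under the involution of `K[A]` that inverts `A`. In the
coinvariants of `∧² P` an element of `A` crosses the wedge as its inverse, and integers cross
freely, so `(c x) ∧ y = x ∧ (c* y)` for every `c` that comes from `ℤ[A]`. Hence, if `Ann(M)` kills
`P`, then `(c x) ∧ y = 0` for all `c` in `𝔧 = Ann(M) + Ann(M)*`, extended to `K[A]`.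

Tameness makes `𝔧` large. If `M` is finitely generated over `ℤ[A_v]`, Nakayama's lemma gives `c`
supported on `{v > 0}` with `1 - c ∈ Ann(M)` (`exists_positive_acting_trivially`); if this holds for
`-v` instead, apply the involution. So every nonzero `v` has such a `c` modulo `𝔧`, and compactness
of the sphere shows that `K[A]/𝔧` is finite over `K` (`finite_quotient_of_positive`), hence
Artinian. The powers of the augmentation ideal `I` stabilize there, and a second use of Nakayama
gives `m₀` and `r ∈ 1 + I` with `r I^m₀ ⊆ 𝔧` (`IsTame.exists_mul_pow_mem`). On a truncation, on the
completion and on the localization, `r` acts surjectively, so `I^m₀ P = I^m₀ r P ⊆ 𝔧 P` dies in the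
coinvariants (`wedgeClass_eq_zero_of_mem_pow_smul`). All these groups therefore depend only on `M_K
/ M_K I^m₀`, and the comparison maps are isomorphisms.

Enlarging the acting group changes nothing, because its elements act by some `l ∈ K[A]` with `l* l ≡
1` modulo powers of `I`, so that `l x ∧ l y = x ∧ l* l y = x ∧ y`. Moving `l` across the wedge
requires that scalars of `K` cross it too, which holds because they are fractions of integers. For
`ℤ[J⁻¹]` the congruence follows from unique divisibility in `1 + I`; for `ℤ/n` one may take `l ∈ A`.

It remains to see that the kernel of `M_K → 𝓜^m_K` lies in `I^m₀ M_K` for large `m`. For the lower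
central series this is an induction on commutators (`Decomposition.lowerCentralSeries_le`). For the
`n`-lower central series it rests on a power map that is a homomorphism with central image in a
nilpotent-by-abelian quotient of `G` (`exists_gammaModAux_inf_ker_eq_bot`). -/

theorem wedgeClass_add_left (x x' y : N) :
    wedgeClass ρ (x + x') y = wedgeClass ρ x y + wedgeClass ρ x' y := by
  have h := (exteriorPower.ιMulti ℤ 2 (M := N)).map_update_add ![x, y] 0 x x'
  have e : ∀ z, Function.update ![x, y] 0 z = ![z, y] := by
    intro z
    ext i
    fin_cases i <;> simp
  rw [e, e, e] at h
  simp only [wedgeClass, h, map_add]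

theorem wedgeClass_swap (x y : N) : wedgeClass ρ x y = -wedgeClass ρ y x := by
  have h := (exteriorPower.ιMulti ℤ 2 (M := N)).map_swap ![y, x] (i := 0) (j := 1) (by simp)
  have e : (![y, x] ∘ Equiv.swap (0 : Fin 2) 1) = ![x, y] := by
    ext i
    fin_cases i <;> simp
  rw [e] at h
  simp only [wedgeClass, h, map_neg]

theorem wedgeClass_add_right (x y y' : N) :
    wedgeClass ρ x (y + y') = wedgeClass ρ x y + wedgeClass ρ x y' := by
  rw [wedgeClass_swap, wedgeClass_add_left, wedgeClass_swap ρ x y, wedgeClass_swap ρ x y']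
  abel

theorem wedgeClass_self (x : N) : wedgeClass ρ x x = 0 := by
  have h := (exteriorPower.ιMulti ℤ 2 (M := N)).map_eq_zero_of_eq ![x, x] (i := 0) (j := 1)
    (by simp) (by simp)
  simp only [wedgeClass, h, map_zero]

/-- The bilinear map `(x, y) ↦ x ∧ y` with values in the coinvariants. -/
def wedgeHom : N →+ N →+ (extSq ρ).Coinvariants :=
  AddMonoidHom.mk' (fun x => AddMonoidHom.mk' (wedgeClass ρ x) (wedgeClass_add_right ρ x))
    (fun x x' => AddMonoidHom.ext fun y => wedgeClass_add_left ρ x x' y)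

theorem wedgeHom_apply (x y : N) : wedgeHom ρ x y = wedgeClass ρ x y := rfl

theorem wedgeClass_act (g : H) (x y : N) :
    wedgeClass ρ (ρ g x) (ρ g y) = wedgeClass ρ x y := by
  have h := Representation.Coinvariants.mk_self_apply (extSq ρ) g
    (exteriorPower.ιMulti ℤ 2 ![x, y])
  have e : extSq ρ g (exteriorPower.ιMulti ℤ 2 ![x, y]) =
      exteriorPower.ιMulti ℤ 2 ![ρ g x, ρ g y] := by
    refine (exteriorPower.map_apply_ιMulti (ρ g) ![x, y]).trans ?_
    congr 1
    ext i
    fin_cases i <;> rfl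
  rw [e] at h
  exact h

variable {W : Type*} [AddCommGroup W]

/-- A bilinear alternating map as an alternating map in two variables. -/
def alternatingOfBilinear (B : N →+ N →+ W) (hB : ∀ x, B x x = 0) : N [⋀^Fin 2]→ₗ[ℤ] W where
  toFun v := B (v 0) (v 1)
  map_update_add' v i x y := by
    fin_cases i <;> simp [Function.update]
  map_update_smul' v i c x := by
    fin_cases i <;> simp [Function.update]
  map_eq_zero_of_eq' v i j h hij := by
    have h01 : v 0 = v 1 := by
      fin_cases i <;> fin_cases j <;> simp_all
    rw [h01, hB]

theorem coinvariants_hom_ext {φ ψ : (extSq ρ).Coinvariants →+ W}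
    (h : ∀ x y, φ (wedgeClass ρ x y) = ψ (wedgeClass ρ x y)) : φ = ψ := by
  have key : (φ.comp (Representation.Coinvariants.mk (extSq ρ)).toAddMonoidHom).toIntLinearMap =
      (ψ.comp (Representation.Coinvariants.mk (extSq ρ)).toAddMonoidHom).toIntLinearMap := by
    refine exteriorPower.linearMap_ext ?_
    ext v
    have hv : v = ![v 0, v 1] := by
      ext i
      fin_cases i <;> rfl
    rw [hv]
    exact h (v 0) (v 1)
  ext x
  obtain ⟨x, rfl⟩ := Representation.Coinvariants.mk_surjective (extSq ρ) x
  exact LinearMap.congr_fun key x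

theorem exists_lift_wedgeClass (B : N →+ N →+ W) (hB : ∀ x, B x x = 0)
    (hρ : ∀ g x y, B (ρ g x) (ρ g y) = B x y) :
    ∃ φ : (extSq ρ).Coinvariants →+ W, ∀ x y, φ (wedgeClass ρ x y) = B x y := by
  refine ⟨(Representation.Coinvariants.lift (extSq ρ)
    (exteriorPower.alternatingMapLinearEquiv (alternatingOfBilinear B hB)) ?_).toAddMonoidHom,
    fun x y => ?_⟩
  · intro g
    refine exteriorPower.linearMap_ext ?_
    ext v
    simp only [LinearMap.compAlternatingMap_apply, LinearMap.comp_apply]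
    have e : extSq ρ g (exteriorPower.ιMulti ℤ 2 v) = exteriorPower.ιMulti ℤ 2 (ρ g ∘ v) :=
      exteriorPower.map_apply_ιMulti (ρ g) v
    rw [e, exteriorPower.alternatingMapLinearEquiv_apply_ιMulti,
      exteriorPower.alternatingMapLinearEquiv_apply_ιMulti]
    exact hρ g (v 0) (v 1)
  · exact exteriorPower.alternatingMapLinearEquiv_apply_ιMulti _ _

/-- A surjection that is compatible with the actions up to classes, and whose kernel dies in the
coinvariants of the exterior square, induces an isomorphism. -/
theorem inducesIso_of_surjective {H' : Type*} [Monoid H'] {N' : Type*} [AddCommGroup N']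
    (ρ' : Representation ℤ H' N') (f : N →+ N') (hf : Function.Surjective f)
    (hker : ∀ x, f x = 0 → ∀ y, wedgeClass ρ x y = 0)
    (hact : ∀ g x y, wedgeClass ρ' (f (ρ g x)) (f (ρ g y)) = wedgeClass ρ' (f x) (f y))
    (hact' : ∀ g' x y x' y', f x' = ρ' g' (f x) → f y' = ρ' g' (f y) →
      wedgeClass ρ x' y' = wedgeClass ρ x y) :
    InducesIso ρ ρ' f := by
  have hl : ∀ x x' y, f x = f x' → wedgeClass ρ x y = wedgeClass ρ x' y := by
    intro x x' y h
    have h1 := hker (x - x') (by rw [map_sub, h, sub_self]) y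
    rw [← wedgeHom_apply, map_sub, AddMonoidHom.sub_apply, sub_eq_zero] at h1
    exact h1
  have hr : ∀ x y y', f y = f y' → wedgeClass ρ x y = wedgeClass ρ x y' := by
    intro x y y' h
    rw [wedgeClass_swap, hl y y' x h, ← wedgeClass_swap]
  obtain ⟨φ, hφ⟩ := exists_lift_wedgeClass ρ
    (AddMonoidHom.mk' (fun x => (wedgeHom ρ' (f x)).comp f)
      (fun x x' => by ext y; simp) : N →+ N →+ (extSq ρ').Coinvariants)
    (fun x => wedgeClass_self ρ' (f x)) hact
  -- A set-theoretic section suffices: by `hl` and `hr` the class of `s x ∧ s y` does not depend on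
  -- the chosen preimages, and this makes it biadditive.
  set s := Function.surjInv hf
  have hs : ∀ x, f (s x) = x := Function.surjInv_eq hf
  obtain ⟨ψ, hψ⟩ := exists_lift_wedgeClass ρ'
    (AddMonoidHom.mk' (fun x => AddMonoidHom.mk' (fun y => wedgeClass ρ (s x) (s y))
      (fun y y' => by
        rw [← wedgeClass_add_right]
        exact hr _ _ _ (by rw [hs, map_add, hs, hs])))
      (fun x x' => by
        ext y
        change _ = wedgeClass ρ (s x) (s y) + wedgeClass ρ (s x') (s y)
        rw [← wedgeClass_add_left]
        exact hl _ _ _ (by rw [hs, map_add, hs, hs])) : N' →+ N' →+ (extSq ρ).Coinvariants)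
    (fun x => wedgeClass_self ρ (s x))
    (fun g x y => hact' g _ _ _ _ (by rw [hs, hs]) (by rw [hs, hs]))
  have hφ' : ∀ x y, φ (wedgeClass ρ x y) = wedgeClass ρ' (f x) (f y) := hφ
  have hψ' : ∀ x y, ψ (wedgeClass ρ' x y) = wedgeClass ρ (s x) (s y) := hψ
  refine ⟨AddMonoidHom.toAddEquiv φ ψ ?_ ?_, hφ'⟩
  · refine coinvariants_hom_ext ρ fun x y => ?_
    simp only [AddMonoidHom.comp_apply, AddMonoidHom.id_apply, hψ', hφ']
    rw [hl _ x _ (hs _), hr _ _ y (hs _)]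
  · refine coinvariants_hom_ext ρ' fun x y => ?_
    simp only [AddMonoidHom.comp_apply, AddMonoidHom.id_apply, hψ', hφ', hs]

/-- Two out of three. It lets a map that need not be surjective be compared with its target through
a common quotient. -/
theorem InducesIso.of_comp {H' H'' : Type*} [Monoid H'] [Monoid H''] {N' N'' : Type*}
    [AddCommGroup N'] [AddCommGroup N''] {ρ : Representation ℤ H N} {ρ' : Representation ℤ H' N'}
    {ρ'' : Representation ℤ H'' N''} {f : N → N'} {g : N' → N''} (hg : InducesIso ρ' ρ'' g)
    (hgf : InducesIso ρ ρ'' (g ∘ f)) : InducesIso ρ ρ' f := by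
  obtain ⟨e, he⟩ := hg
  obtain ⟨e', he'⟩ := hgf
  refine ⟨e'.trans e.symm, fun x y => ?_⟩
  rw [AddEquiv.trans_apply, AddEquiv.symm_apply_eq, he, he']
  rfl

/-- Invariance on pure wedges makes the projection to the `ρ'`-coinvariants factor through the
`ρ`-coinvariants. Two such inclusions express that two groups give the same quotient. -/
theorem coinvariants_ker_le {H' : Type*} [Monoid H'] (ρ' : Representation ℤ H' N)
    (h : ∀ g x y, wedgeClass ρ' (ρ g x) (ρ g y) = wedgeClass ρ' x y) :
    Representation.Coinvariants.ker (extSq ρ) ≤ Representation.Coinvariants.ker (extSq ρ') := by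
  obtain ⟨φ, hφ⟩ := exists_lift_wedgeClass ρ (wedgeHom ρ') (wedgeClass_self ρ') h
  intro x hx
  rw [← Representation.Coinvariants.mk_eq_zero] at hx ⊢
  have key : (φ.comp (Representation.Coinvariants.mk (extSq ρ)).toAddMonoidHom).toIntLinearMap =
      (Representation.Coinvariants.mk (extSq ρ')).toAddMonoidHom.toIntLinearMap := by
    refine exteriorPower.linearMap_ext ?_
    ext v
    have hv : v = ![v 0, v 1] := by
      ext i
      fin_cases i <;> rfl
    rw [hv]
    exact hφ (v 0) (v 1)
  refine (LinearMap.congr_fun key x).symm.trans ?_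
  change φ (Representation.Coinvariants.mk (extSq ρ) x) = 0
  rw [hx, map_zero]

end Wedge

/-! ### Tameness and the diagonal quotient of the group ring -/

section Involution

variable (k A : Type*) [CommRing k] [CommGroup A]

/-- The involution of `k[A]` that inverts the elements of `A`. -/
def involution : MonoidAlgebra k A →+* MonoidAlgebra k A :=
  MonoidAlgebra.mapDomainRingHom k (invMonoidHom : A →* A)

variable {k A}

theorem involution_of (a : A) :
    involution k A (MonoidAlgebra.of k A a) = MonoidAlgebra.of k A a⁻¹ := by
  simp [involution]

theorem involution_smul (r : k) (x : MonoidAlgebra k A) :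
    involution k A (r • x) = r • involution k A x := by
  have h : involution k A (algebraMap k _ r) = algebraMap k _ r := by
    simp [involution]
  rw [Algebra.smul_def, map_mul, h, ← Algebra.smul_def]

theorem involution_involution (x : MonoidAlgebra k A) :
    involution k A (involution k A x) = x := by
  induction x using MonoidAlgebra.induction_on with
  | of a => rw [involution_of, involution_of, inv_inv]
  | add x y hx hy => rw [map_add, map_add, hx, hy]
  | smul r x hx => rw [involution_smul, involution_smul, hx]

theorem involution_grMap {k' : Type*} [CommRing k'] (f : k →+* k') (x : MonoidAlgebra k A) :
    involution k' A (grMap A f x) = grMap A f (involution k A x) :=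
  (RingHom.congr_fun (MonoidAlgebra.mapRingHom_comp_mapDomainRingHom f
    (invMonoidHom : A →* A)) x).symm

theorem augmentation_involution (x : MonoidAlgebra k A) :
    augmentation k A (involution k A x) = augmentation k A x := by
  induction x using MonoidAlgebra.induction_on with
  | of a => rw [involution_of]; simp [augmentation]
  | add x y hx hy => rw [map_add, map_add, map_add, hx, hy]
  | smul r x hx =>
    rw [involution_smul]
    have : ∀ y, augmentation k A (r • y) = r * augmentation k A y := by simp [augmentation]
    rw [this, this, hx]

theorem augIdeal_le_comap_involution :
    augIdeal k A ≤ (augIdeal k A).comap (involution k A) := by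
  intro x hx
  rw [augIdeal, RingHom.mem_ker] at hx
  rw [Ideal.mem_comap, augIdeal, RingHom.mem_ker, augmentation_involution, hx]

end Involution

section PositiveSpan

variable (k : Type*) {A : Type*} [CommRing k] [CommGroup A] (v : Additive A →+ ℝ)

/-- The elements of `k[A]` supported on `{a | 0 < v a}`. -/
def positiveSpan : Submodule k (MonoidAlgebra k A) :=
  Submodule.span k (MonoidAlgebra.of k A '' {a | 0 < v (Additive.ofMul a)})

variable {k v}

theorem grMap_mem_positiveSpan {k' : Type*} [CommRing k'] (f : k →+* k')
    {x : MonoidAlgebra k A} (hx : x ∈ positiveSpan k v) : grMap A f x ∈ positiveSpan k' v := by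
  induction hx using Submodule.span_induction with
  | mem x hx =>
    obtain ⟨a, ha, rfl⟩ := hx
    exact Submodule.subset_span ⟨a, ha, by simp [MonoidAlgebra.of_apply]⟩
  | zero => rw [map_zero]; exact Submodule.zero_mem _
  | add x y _ _ hx hy => rw [map_add]; exact Submodule.add_mem _ hx hy
  | smul r x _ hx =>
    have : grMap A f (r • x) = f r • grMap A f x := by
      ext a
      simp
    rw [this]
    exact Submodule.smul_mem _ _ hx

theorem involution_mem_positiveSpan {x : MonoidAlgebra k A} (hx : x ∈ positiveSpan k (-v)) :
    involution k A x ∈ positiveSpan k v := by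
  induction hx using Submodule.span_induction with
  | mem x hx =>
    obtain ⟨a, ha, rfl⟩ := hx
    rw [involution_of]
    exact Submodule.subset_span ⟨a⁻¹, by simpa using ha, rfl⟩
  | zero => rw [map_zero]; exact Submodule.zero_mem _
  | add x y _ _ hx hy => rw [map_add]; exact Submodule.add_mem _ hx hy
  | smul r x _ hx => rw [involution_smul]; exact Submodule.smul_mem _ _ hx

end PositiveSpan

section TameFinite

variable {A : Type*} [CommGroup A] {M : Type*} [AddCommGroup M] [Module (MonoidAlgebra ℤ A) M]

/-- Nakayama's lemma over `B = ℤ[A_v]`, for the ideal `I` of elements supported on `{v > 0}`. An `a`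
with `v a > 0` lies in `I` and is invertible in `ℤ[A]`, so `I M = M`. As `M` is finitely generated
over `B`, some `r ∈ 1 + I` kills `M`, and `c = 1 - r`. -/
theorem exists_positive_acting_trivially {v : Additive A →+ ℝ} (hv : v ∈ bieriStrebel A M) :
    ∃ c ∈ positiveSpan ℤ v, ∀ x : M, c • x = x := by
  obtain ⟨hv0, hfin⟩ := hv
  set B := (MonoidAlgebra.mapDomainAlgHom ℤ ℤ (valuationMonoid A v).subtype).range with hB
  have hBle : ∀ b ∈ B, b ∈ Submodule.span ℤ
      (MonoidAlgebra.of ℤ A '' {a | 0 ≤ v (Additive.ofMul a)}) := by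
    rintro _ ⟨x, rfl⟩
    induction x using MonoidAlgebra.induction_on with
    | of a =>
      refine Submodule.subset_span ⟨a, a.2, ?_⟩
      simp
    | add x y hx hy => rw [map_add]; exact Submodule.add_mem _ hx hy
    | smul r x hx => rw [map_zsmul]; exact Submodule.smul_mem _ _ hx
  have hmul : ∀ b ∈ B, ∀ c ∈ positiveSpan ℤ v, b * c ∈ positiveSpan ℤ v := by
    intro b hb c hc
    have h := Submodule.mul_mem_mul (hBle b hb) hc
    rw [positiveSpan, Submodule.span_mul_span] at h
    refine Submodule.span_mono ?_ h
    rintro _ ⟨_, ⟨a, ha, rfl⟩, _, ⟨a', ha', rfl⟩, rfl⟩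
    refine ⟨a * a', ?_, map_mul _ _ _⟩
    simp only [Set.mem_ofPred_eq, ofMul_mul, map_add] at *
    exact add_pos_of_nonneg_of_pos ha ha'
  let I : Ideal B :=
    { carrier := {b | (b : MonoidAlgebra ℤ A) ∈ positiveSpan ℤ v}
      zero_mem' := (positiveSpan ℤ v).zero_mem
      add_mem' := fun hx hy => (positiveSpan ℤ v).add_mem hx hy
      smul_mem' := fun b c hc => hmul b b.2 c hc }
  obtain ⟨a, ha⟩ : ∃ a : A, 0 < v (Additive.ofMul a) := by
    by_contra! h
    refine hv0 (AddMonoidHom.ext fun a => le_antisymm (h a.toMul) ?_)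
    have := h a.toMul⁻¹
    simpa using this
  have hle : (⊤ : Submodule B M) ≤ I • ⊤ := by
    intro x _
    have haB : MonoidAlgebra.of ℤ A a ∈ B :=
      ⟨MonoidAlgebra.of ℤ _ (⟨a, ha.le⟩ : valuationMonoid A v), by simp⟩
    have haI : (⟨_, haB⟩ : B) ∈ I := Submodule.subset_span ⟨a, ha, rfl⟩
    have h := Submodule.smul_mem_smul haI
      (Submodule.mem_top (R := B) (x := MonoidAlgebra.of ℤ A a⁻¹ • x))
    rwa [Subalgebra.smul_def, smul_smul, ← map_mul, mul_inv_cancel, map_one, one_smul] at h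
  obtain ⟨r, hr, hr0⟩ := Submodule.exists_sub_one_mem_and_smul_eq_zero_of_fg_of_le_smul I
    (⊤ : Submodule B M) hfin.fg_top hle
  refine ⟨1 - r, ?_, fun x => ?_⟩
  · have h : ((r - 1 : B) : MonoidAlgebra ℤ A) ∈ positiveSpan ℤ v := hr
    have := Submodule.neg_mem _ h
    simpa using this
  · have h : (r : MonoidAlgebra ℤ A) • x = 0 := hr0 x Submodule.mem_top
    rw [sub_smul, one_smul, h, sub_zero]

variable (A M) in
/-- The sum of the annihilator of `M` and its image under the involution. It annihilates
`M ⊗ M` in the coinvariants for the diagonal action. -/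
def diagonalIdeal : Ideal (MonoidAlgebra ℤ A) :=
  Module.annihilator (MonoidAlgebra ℤ A) M ⊔
    (Module.annihilator (MonoidAlgebra ℤ A) M).map (involution ℤ A)

/-- The involution carries support in `{-v > 0}` to support in `{v > 0}`. This is why the involuted
annihilator is added: tameness gives only one of `v`, `-v`, but the sum of the two ideals serves
every direction. -/
theorem IsTame.exists_positive (hM : IsTame A M) {v : Additive A →+ ℝ} (hv : v ≠ 0) :
    ∃ c ∈ positiveSpan ℤ v, 1 - c ∈ diagonalIdeal A M := by
  have key : ∀ w ∈ bieriStrebel A M, ∃ c ∈ positiveSpan ℤ w,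
      1 - c ∈ Module.annihilator (MonoidAlgebra ℤ A) M := by
    intro w hw
    obtain ⟨c, hc, h⟩ := exists_positive_acting_trivially hw
    refine ⟨c, hc, Module.mem_annihilator.2 fun x => ?_⟩
    rw [sub_smul, one_smul, h, sub_self]
  have h : v ∈ bieriStrebel A M ∪ {v | -v ∈ bieriStrebel A M} := by
    rw [hM.sphere]
    exact hv
  rcases h with h | h
  · obtain ⟨c, hc, hc1⟩ := key v h
    exact ⟨c, hc, Ideal.mem_sup_left hc1⟩
  · obtain ⟨c, hc, hc1⟩ := key (-v) h
    refine ⟨involution ℤ A c, involution_mem_positiveSpan hc, Ideal.mem_sup_right ?_⟩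
    have := Ideal.mem_map_of_mem (involution ℤ A) hc1
    rwa [map_sub, map_one] at this

end TameFinite

/-! ### Finiteness of a quotient of the group ring, by descent on the norm. -/

section Descent

variable (A : Type*) [CommGroup A] [Group.FG A]

/-- Modulo its finite torsion subgroup, `A` is a lattice in `ℝ^d`; bounded sets contain finitely
many lattice points, and finite torsion keeps the preimages finite. -/
theorem exists_euclidean_coordinates :
    ∃ (d : ℕ) (ρ : Additive A →+ EuclideanSpace ℝ (Fin d)),
      (∀ R : ℝ, {a | ‖ρ a‖ ≤ R}.Finite) ∧ ∀ e ≠ 0, ∃ a, inner ℝ e (ρ a) ≠ 0 := by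
  obtain ⟨d, ι, _, p, hp, q, ⟨f⟩⟩ := AddCommGroup.equiv_free_prod_directSum_zmod (Additive A)
  have : ∀ i, NeZero (p i ^ q i) := fun i => ⟨pow_ne_zero _ (hp i).ne_zero⟩
  have : ∀ i, Finite (ZMod (p i ^ q i)) := fun i => inferInstance
  have : Finite (DirectSum ι fun i => ZMod (p i ^ q i)) :=
    Finite.of_equiv _ (DirectSum.addEquivProd fun i => ZMod (p i ^ q i)).symm.toEquiv
  let ρ : Additive A →+ EuclideanSpace ℝ (Fin d) := AddMonoidHom.mk'
    (fun a => WithLp.toLp 2 fun i => (((f a).1 i : ℤ) : ℝ))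
    (fun a b => by ext i; simp)
  have hρ : ∀ a i, ρ a i = (((f a).1 i : ℤ) : ℝ) := fun a i => rfl
  refine ⟨d, ρ, fun R => ?_, fun e he => ?_⟩
  · have hS : {z : Fin d → ℤ | ∀ i, z i ∈ Set.Icc (-⌈R⌉) ⌈R⌉}.Finite := by
      have := Set.Finite.pi (ι := Fin d) (t := fun _ => Set.Icc (-⌈R⌉) ⌈R⌉)
        (fun _ => Set.finite_Icc _ _)
      refine this.subset fun z hz => ?_
      exact Set.mem_univ_pi.2 hz
    have hT := (hS.prod (Set.finite_univ (α := DirectSum ι fun i => ZMod (p i ^ q i)))).preimage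
      (f := fun a : Additive A => ((⇑(f a).1 : Fin d → ℤ), (f a).2)) (by
        intro a _ b _ hab
        simp only [Prod.mk.injEq, DFunLike.coe_fn_eq] at hab
        exact f.injective (Prod.ext hab.1 hab.2))
    refine hT.subset fun a ha => ?_
    refine ⟨fun i => ?_, Set.mem_univ _⟩
    have h1 : |(((f a).1 i : ℤ) : ℝ)| ≤ R := by
      rw [← hρ, ← Real.norm_eq_abs]
      exact (PiLp.norm_apply_le (ρ a) i).trans ha
    have h2 := abs_le.1 (h1.trans (Int.le_ceil R))
    exact ⟨by exact_mod_cast h2.1, by exact_mod_cast h2.2⟩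
  · obtain ⟨i, hi⟩ : ∃ i, e i ≠ 0 := by
      by_contra! h
      exact he (by ext i; exact h i)
    refine ⟨f.symm (Finsupp.single i 1, 0), ?_⟩
    have : ρ (f.symm (Finsupp.single i 1, 0)) = EuclideanSpace.single i 1 := by
      ext j
      rw [hρ, AddEquiv.apply_symm_apply]
      by_cases h : j = i <;> simp [h]
    rw [this, EuclideanSpace.inner_single_right]
    simpa using hi

variable {A}

/-- The finiteness theorem of Bieri and Strebel for quotients of the group ring: if the Bieri-Strebel
invariant of `k[A] / 𝔧` is the whole sphere, then `k[A] / 𝔧` is a finite `k`-module. -/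
theorem finite_quotient_of_positive {k : Type*} [CommRing k] (𝔧 : Ideal (MonoidAlgebra k A))
    (h𝔧 : ∀ v : Additive A →+ ℝ, v ≠ 0 → ∃ c ∈ positiveSpan k v, 1 - c ∈ 𝔧) :
    Module.Finite k (MonoidAlgebra k A ⧸ 𝔧) := by
  classical
  obtain ⟨d, ρ, hfin, hne⟩ := exists_euclidean_coordinates A
  let vv : EuclideanSpace ℝ (Fin d) → Additive A →+ ℝ := fun e =>
    (innerSL ℝ e : EuclideanSpace ℝ (Fin d) →ₗ[ℝ] ℝ).toAddMonoidHom.comp ρ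
  have hvv : ∀ e a, vv e a = inner ℝ e (ρ a) := fun e a => rfl
  -- the index set of the cover: finite subsets `T` of `A` that support some `c` as in `h𝔧`
  let good : Set (Finset A) := {T | ∃ c ∈ Submodule.span k (MonoidAlgebra.of k A '' (T : Set A)), 1 - c ∈ 𝔧}
  -- The inequality says that for `x = -s e` with `‖e‖ = 1` and `s ≥ t.2`, adding `ρ b` shortens
  -- `x`: `‖x + ρ b‖² = s² - 2 s ⟨e, ρ b⟩ + ‖ρ b‖² < s²`. It is an open condition on `e`.
  let U : good × ℕ → Set (EuclideanSpace ℝ (Fin d)) := fun t =>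
    ⋂ b ∈ t.1.1, {e | ‖ρ (Additive.ofMul b)‖ ^ 2 < 2 * t.2 * inner ℝ e (ρ (Additive.ofMul b))}
  have hU : ∀ t, IsOpen (U t) := fun t =>
    isOpen_biInter_finset fun b _ => isOpen_lt continuous_const (by fun_prop)
  have hcov : Metric.sphere (0 : EuclideanSpace ℝ (Fin d)) 1 ⊆ ⋃ t, U t := by
    intro e he
    have he0 : e ≠ 0 := by
      rintro rfl
      simp at he
    obtain ⟨a, ha⟩ := hne e he0
    obtain ⟨c, hc, hc1⟩ := h𝔧 (vv e) (fun h => ha (by rw [← hvv, h]; rfl))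
    obtain ⟨T, hT, hcT⟩ := Submodule.mem_span_finite_of_mem_span hc
    obtain ⟨T', hT', rfl⟩ := Finset.subset_set_image_iff.1 hT
    have hpos : ∀ b ∈ T', 0 < inner ℝ e (ρ (Additive.ofMul b)) := fun b hb => hT' hb
    have hN : ∃ N : ℕ, ∀ b ∈ T',
        ‖ρ (Additive.ofMul b)‖ ^ 2 < 2 * N * inner ℝ e (ρ (Additive.ofMul b)) := by
      have : ∀ b : A, ∃ N : ℕ, b ∈ T' →
          ‖ρ (Additive.ofMul b)‖ ^ 2 < 2 * N * inner ℝ e (ρ (Additive.ofMul b)) := by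
        intro b
        by_cases hb : b ∈ T'
        · obtain ⟨N, hN⟩ := exists_nat_gt
            (‖ρ (Additive.ofMul b)‖ ^ 2 / (2 * inner ℝ e (ρ (Additive.ofMul b))))
          refine ⟨N, fun _ => ?_⟩
          rw [div_lt_iff₀ (by linarith [hpos b hb])] at hN
          linarith
        · exact ⟨0, fun h => absurd h hb⟩
      choose N hN using this
      refine ⟨T'.sup N, fun b hb => (hN b hb).trans_le ?_⟩
      have h1 : (N b : ℝ) ≤ (T'.sup N : ℕ) := by exact_mod_cast Finset.le_sup hb
      have := (hpos b hb).le
      gcongr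
    obtain ⟨N, hN⟩ := hN
    refine Set.mem_iUnion.2 ⟨⟨⟨T', c, by simpa using hcT, hc1⟩, N⟩, ?_⟩
    simpa [U] using hN
  obtain ⟨F, hF⟩ := (isCompact_sphere (0 : EuclideanSpace ℝ (Fin d)) 1).elim_finite_subcover U hU
    hcov
  -- Outside the ball of radius `R`, every direction belongs to one of finitely many sets `U t`,
  -- whose threshold `t.2` is at most `R`.
  set R : ℕ := F.sup fun t => t.2
  have hball := hfin R
  let Q : Submodule k (MonoidAlgebra k A ⧸ 𝔧) := Submodule.span k
    ((fun a : Additive A => Ideal.Quotient.mk 𝔧 (MonoidAlgebra.of k A a.toMul)) ''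
      {a | ‖ρ a‖ ≤ R})
  have hQ : ∀ a : A, Ideal.Quotient.mk 𝔧 (MonoidAlgebra.of k A a) ∈ Q := by
    intro a
    -- Norms are real, so the descent is made well-founded by counting the finitely many elements of
    -- smaller norm.
    induction hn : {b | ‖ρ b‖ < ‖ρ (Additive.ofMul a)‖}.ncard using Nat.strong_induction_on
      generalizing a with
    | _ n ih =>
      by_cases haR : ‖ρ (Additive.ofMul a)‖ ≤ R
      · exact Submodule.subset_span ⟨Additive.ofMul a, haR, rfl⟩
      push Not at haR
      have hpos : 0 < ‖ρ (Additive.ofMul a)‖ := (Nat.cast_nonneg R).trans_lt haR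
      set x := ρ (Additive.ofMul a) with hx
      have he : -(‖x‖⁻¹ • x) ∈ Metric.sphere (0 : EuclideanSpace ℝ (Fin d)) 1 := by
        simp [norm_smul, hpos.ne']
      obtain ⟨t, ht⟩ := Set.mem_iUnion.1 (hF he)
      obtain ⟨htF, ht⟩ := Set.mem_iUnion.1 ht
      have hlt : ∀ b ∈ t.1.1, ‖ρ (Additive.ofMul (a * b))‖ < ‖x‖ := by
        intro b hb
        have h1 : ‖ρ (Additive.ofMul b)‖ ^ 2 <
            2 * t.2 * inner ℝ (-(‖x‖⁻¹ • x)) (ρ (Additive.ofMul b)) := by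
          have := Set.mem_iInter₂.1 ht b hb
          exact this
        rw [inner_neg_left, real_inner_smul_left] at h1
        set s := inner ℝ x (ρ (Additive.ofMul b))
        have h2 : ‖ρ (Additive.ofMul (a * b))‖ ^ 2 =
            ‖x‖ ^ 2 + 2 * s + ‖ρ (Additive.ofMul b)‖ ^ 2 := by
          rw [ofMul_mul, map_add, norm_add_sq_real]
        have h3 : (t.2 : ℝ) ≤ ‖x‖ :=
          (show (t.2 : ℝ) ≤ R by exact_mod_cast Finset.le_sup (f := fun t => t.2) htF).trans haR.le
        have h4 : 0 < -(‖x‖⁻¹ * s) := by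
          by_contra! h
          have h5 : 2 * (t.2 : ℝ) * -(‖x‖⁻¹ * s) ≤ 0 :=
            mul_nonpos_of_nonneg_of_nonpos (by positivity) h
          nlinarith [sq_nonneg ‖ρ (Additive.ofMul b)‖]
        have h5 : 2 * (t.2 : ℝ) * -(‖x‖⁻¹ * s) ≤ 2 * ‖x‖ * -(‖x‖⁻¹ * s) := by gcongr
        have h6 : 2 * ‖x‖ * -(‖x‖⁻¹ * s) = -(2 * s) := by field_simp
        refine lt_of_pow_lt_pow_left₀ 2 hpos.le ?_
        rw [h2]
        linarith
      obtain ⟨c, hc, hc1⟩ := t.1.2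
      -- Modulo `𝔧`, `a` equals `a c`, a combination of elements `a b` of strictly smaller norm.
      have hac : Ideal.Quotient.mk 𝔧 (MonoidAlgebra.of k A a) =
          Ideal.Quotient.mk 𝔧 (MonoidAlgebra.of k A a * c) := by
        rw [Ideal.Quotient.eq]
        have := 𝔧.mul_mem_left (MonoidAlgebra.of k A a) hc1
        rwa [mul_sub, mul_one] at this
      rw [hac]
      clear hac hc1
      induction hc using Submodule.span_induction with
      | mem y hy =>
        obtain ⟨b, hb, rfl⟩ := hy
        rw [← map_mul]
        refine ih _ ?_ (a * b) rfl
        rw [← hn]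
        refine Set.ncard_lt_ncard ⟨fun z hz => ?_, fun h => ?_⟩
          ((hfin ‖x‖).subset fun z (hz : ‖ρ z‖ < ‖x‖) => hz.le)
        · exact lt_trans hz (hlt b hb)
        · exact lt_irrefl ‖ρ (Additive.ofMul (a * b))‖ (h (a := Additive.ofMul (a * b)) (hlt b hb))
      | zero => rw [mul_zero, map_zero]; exact Submodule.zero_mem _
      | add y z _ _ hy hz => rw [mul_add, map_add]; exact Submodule.add_mem _ hy hz
      | smul r y _ hy =>
        rw [mul_smul_comm]
        exact Submodule.smul_mem _ r hy
  have htop : Q = ⊤ := by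
    rw [eq_top_iff]
    rintro x -
    obtain ⟨x, rfl⟩ := Ideal.Quotient.mk_surjective x
    induction x using MonoidAlgebra.induction_on with
    | of a => exact hQ a
    | add x y hx hy =>
      rw [map_add]
      exact Submodule.add_mem _ hx hy
    | smul r x hx => exact Submodule.smul_mem _ r hx
  exact ⟨Submodule.fg_def.2 ⟨_, hball.image _, htop⟩⟩

end Descent

/-! ### Vanishing of wedge products -/

/-- In the Artinian quotient the powers of the image of `I` stabilize, so the stable power `𝔞`
satisfies `I 𝔞 = 𝔞`. By Nakayama's lemma an element of `1 + I` kills it. -/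
theorem exists_mul_pow_mem_of_isArtinianRing {Λ : Type*} [CommRing Λ] (I 𝔧 : Ideal Λ)
    [IsArtinianRing (Λ ⧸ 𝔧)] :
    ∃ (m₀ : ℕ) (r : Λ), r - 1 ∈ I ∧ ∀ i ∈ I ^ m₀, r * i ∈ 𝔧 := by
  set q := Ideal.Quotient.mk 𝔧
  obtain ⟨m₀, hm₀⟩ := IsArtinian.monotone_stabilizes (R := Λ ⧸ 𝔧) (M := Λ ⧸ 𝔧)
    ⟨fun m => OrderDual.toDual (I.map q ^ m), fun m m' h => Ideal.pow_le_pow_right h⟩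
  have h1 : I.map q ^ m₀ = I.map q ^ (m₀ + 1) := hm₀ (m₀ + 1) (Nat.le_succ _)
  obtain ⟨r, hr, hr0⟩ := Submodule.exists_sub_one_mem_and_smul_eq_zero_of_fg_of_le_smul
    (I.map q) (I.map q ^ m₀) (IsNoetherian.noetherian _)
    (by rw [smul_eq_mul, ← pow_succ', ← h1])
  obtain ⟨i, hi, hir⟩ := (Ideal.mem_map_iff_of_surjective q Ideal.Quotient.mk_surjective).1 hr
  refine ⟨m₀, 1 + i, by simpa using hi, fun j hj => ?_⟩
  rw [← Ideal.Quotient.eq_zero_iff_mem, map_mul, map_add, hir, map_one, add_sub_cancel]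
  refine hr0 _ ?_
  rw [← Ideal.map_pow]
  exact Ideal.mem_map_of_mem _ hj

/-- The extension of the diagonal ideal of `M` to `K[A]`. -/
def diagonalIdealK (A : Type*) [CommGroup A] (M : Type*) [AddCommGroup M]
    [Module (MonoidAlgebra ℤ A) M] (K : Type*) [CommRing K] : Ideal (MonoidAlgebra K A) :=
  (diagonalIdeal A M).map (grMap A (Int.castRingHom K))

/-- Source of the bound `m₀` and of the element `r` on which all later vanishing depends. The
elements given by tameness keep their positive support over `K`, so `K[A]` modulo the extended ideal
is finite over the Artinian ring `K`, hence Artinian. -/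
theorem IsTame.exists_mul_pow_mem {A : Type*} [CommGroup A] [Group.FG A] {M : Type*}
    [AddCommGroup M] [Module (MonoidAlgebra ℤ A) M] (hM : IsTame A M) (K : Type*) [CommRing K]
    [IsArtinianRing K] :
    ∃ (m₀ : ℕ) (r : MonoidAlgebra K A), r - 1 ∈ augIdeal K A ∧
      ∀ i ∈ augIdeal K A ^ m₀, r * i ∈ diagonalIdealK A M K := by
  have hfin : Module.Finite K (MonoidAlgebra K A ⧸ diagonalIdealK A M K) := by
    refine finite_quotient_of_positive _ fun v hv => ?_
    obtain ⟨c, hc, hc1⟩ := hM.exists_positive hv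
    refine ⟨_, grMap_mem_positiveSpan (Int.castRingHom K) hc, ?_⟩
    have := Ideal.mem_map_of_mem (grMap A (Int.castRingHom K)) hc1
    rwa [map_sub, map_one] at this
  have := IsArtinianRing.of_finite K (MonoidAlgebra K A ⧸ diagonalIdealK A M K)
  exact exists_mul_pow_mem_of_isArtinianRing _ _

/-- Every element of `K` is a fraction of integers, the denominator being invertible in `K`. -/
def HasIntFractions (K : Type*) [CommRing K] : Prop :=
  ∀ k : K, ∃ s t : ℤ, IsUnit (s : K) ∧ (s : K) * k = t

section Vanishing

variable {A : Type*} [CommGroup A] {K : Type*} [CommRing K] {P : Type*} [AddCommGroup P]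
  [Module (MonoidAlgebra K A) P]

theorem actA_apply (a : A) (x : P) : actA A K P a x = MonoidAlgebra.of K A a • x := rfl

theorem wedgeClass_of_smul_left (a : A) (x y : P) :
    wedgeClass (actA A K P) (MonoidAlgebra.of K A a • x) y =
      wedgeClass (actA A K P) x (MonoidAlgebra.of K A a⁻¹ • y) := by
  have h := wedgeClass_act (actA A K P) a x (MonoidAlgebra.of K A a⁻¹ • y)
  rw [actA_apply, actA_apply, smul_smul, ← map_mul, mul_inv_cancel, map_one, one_smul] at h
  exact h

theorem wedgeClass_zsmul_left (r : ℤ) (x y : P) :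
    wedgeClass (actA A K P) (r • x) y = wedgeClass (actA A K P) x (r • y) := by
  simp only [← wedgeHom_apply, map_zsmul, AddMonoidHom.smul_apply]

/-- The exterior square is taken over `ℤ`, so a scalar of `K` crosses the wedge only for a reason;
`Λ₀` is a set of scalars known to do so. Given this for the coefficients of `c`, the group elements
cross as inverses and produce the involution. -/
theorem wedgeClass_smul_left_of_balanced (Λ₀ : Set K)
    (hbal : ∀ r ∈ Λ₀, ∀ x y : P,
      wedgeClass (actA A K P) (algebraMap K (MonoidAlgebra K A) r • x) y =
        wedgeClass (actA A K P) x (algebraMap K (MonoidAlgebra K A) r • y))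
    {c : MonoidAlgebra K A} (hc : ∀ a, c.coeff a ∈ Λ₀) (x y : P) :
    wedgeClass (actA A K P) (c • x) y = wedgeClass (actA A K P) x (involution K A c • y) := by
  have hsum : c = ∑ a ∈ c.coeff.support,
      algebraMap K (MonoidAlgebra K A) (c.coeff a) * MonoidAlgebra.of K A a := by
    conv_lhs => rw [← MonoidAlgebra.sum_coeff_single c]
    refine Finset.sum_congr rfl fun a _ => ?_
    simp [MonoidAlgebra.of_apply]
  conv_lhs => rw [hsum]
  conv_rhs => rw [hsum]
  rw [map_sum, Finset.sum_smul, Finset.sum_smul]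
  simp only [← wedgeHom_apply, map_sum, AddMonoidHom.finsetSum_apply]
  refine Finset.sum_congr rfl fun a _ => ?_
  simp only [wedgeHom_apply]
  have h : involution K A (algebraMap K _ (c.coeff a)) = algebraMap K _ (c.coeff a) := by
    simp [involution]
  rw [map_mul, h, involution_of, mul_smul, hbal _ (hc a), wedgeClass_of_smul_left, smul_smul,
    mul_comm]

theorem wedgeClass_grMap_smul_left (c : MonoidAlgebra ℤ A) (x y : P) :
    wedgeClass (actA A K P) (grMap A (Int.castRingHom K) c • x) y =
      wedgeClass (actA A K P) x (involution K A (grMap A (Int.castRingHom K) c) • y) := by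
  refine wedgeClass_smul_left_of_balanced (Set.range ((↑) : ℤ → K)) ?_ ?_ x y
  · rintro _ ⟨r, rfl⟩ x y
    rw [map_intCast, Int.cast_smul_eq_zsmul, Int.cast_smul_eq_zsmul, wedgeClass_zsmul_left]
  · intro a
    exact ⟨c.coeff a, by simp⟩

/-- If `s k = t` with integers `s`, `t` and `s` invertible, write `y = s y'`. Then `k x ∧ s y' = s k
x ∧ y' = t x ∧ y' = x ∧ t y' = x ∧ k s y'`. -/
theorem wedgeClass_smul_left (hK : HasIntFractions K) (c : MonoidAlgebra K A) (x y : P) :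
    wedgeClass (actA A K P) (c • x) y = wedgeClass (actA A K P) x (involution K A c • y) := by
  refine wedgeClass_smul_left_of_balanced Set.univ ?_ (fun _ => Set.mem_univ _) x y
  rintro k - x y
  obtain ⟨s, t, hs, hst⟩ := hK k
  have hy : ∃ y', y = s • y' := by
    obtain ⟨u, hu⟩ := hs
    refine ⟨algebraMap K (MonoidAlgebra K A) ((u⁻¹ : Kˣ) : K) • y, ?_⟩
    rw [← Int.cast_smul_eq_zsmul (MonoidAlgebra K A), smul_smul,
      ← map_intCast (algebraMap K (MonoidAlgebra K A)), ← map_mul, ← hu, Units.mul_inv, map_one,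
      one_smul]
  obtain ⟨y, rfl⟩ := hy
  have h : ∀ z : P, s • algebraMap K (MonoidAlgebra K A) k • z = t • z := by
    intro z
    rw [← Int.cast_smul_eq_zsmul (MonoidAlgebra K A), smul_smul,
      ← map_intCast (algebraMap K (MonoidAlgebra K A)), ← map_mul, hst, map_intCast,
      Int.cast_smul_eq_zsmul]
  rw [← wedgeClass_zsmul_left, h, smul_comm _ s y, h, wedgeClass_zsmul_left]

variable {M : Type*} [AddCommGroup M] [Module (MonoidAlgebra ℤ A) M]

theorem wedgeClass_diagonalIdealK_smul
    (hP : ∀ c ∈ Module.annihilator (MonoidAlgebra ℤ A) M, ∀ x : P,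
      grMap A (Int.castRingHom K) c • x = 0)
    {c : MonoidAlgebra K A} (hc : c ∈ diagonalIdealK A M K) (x y : P) :
    wedgeClass (actA A K P) (c • x) y = 0 := by
  have hadd : ∀ x x' : P, wedgeClass (actA A K P) x y = 0 → wedgeClass (actA A K P) x' y = 0 →
      wedgeClass (actA A K P) (x + x') y = 0 := by
    intro x x' h h'
    rw [wedgeClass_add_left, h, h', add_zero]
  have h0 : ∀ y : P, wedgeClass (actA A K P) 0 y = 0 := by
    intro y
    rw [← wedgeHom_apply, map_zero, AddMonoidHom.zero_apply]
  have h0' : ∀ x : P, wedgeClass (actA A K P) x 0 = 0 := by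
    intro x
    rw [← wedgeHom_apply, map_zero]
  induction hc using Submodule.span_induction generalizing x with
  | mem c hc =>
    obtain ⟨c, hc, rfl⟩ := hc
    obtain ⟨c, hc₁, c', hc', rfl⟩ := Submodule.mem_sup.1 hc
    rw [map_add, add_smul]
    refine hadd _ _ (by rw [hP c hc₁, h0]) ?_
    -- The summand from the involuted annihilator crosses the wedge, where the involution turns it
    -- back into the annihilator.
    rw [wedgeClass_grMap_smul_left, involution_grMap, hP, h0']
    have hle : (Module.annihilator (MonoidAlgebra ℤ A) M).map (involution ℤ A) ≤
        (Module.annihilator (MonoidAlgebra ℤ A) M).comap (involution ℤ A) := by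
      rw [Ideal.map_le_iff_le_comap]
      intro b hb
      rw [Ideal.mem_comap, Ideal.mem_comap, involution_involution]
      exact hb
    exact hle hc'
  | zero => rw [zero_smul, h0]
  | add c c' _ _ h h' => rw [add_smul]; exact hadd _ _ (h x) (h' x)
  | smul b c _ h =>
    -- The factor `b` is absorbed into `x`, which is why the induction generalizes `x`; `b` itself
    -- need not cross the wedge.
    rw [smul_eq_mul, mul_comm, mul_smul]
    exact h _

/-- High powers of the augmentation ideal die in the coinvariants of the exterior square. -/
theorem wedgeClass_eq_zero_of_mem_pow_smul
    (hP : ∀ c ∈ Module.annihilator (MonoidAlgebra ℤ A) M, ∀ x : P,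
      grMap A (Int.castRingHom K) c • x = 0)
    {m₀ : ℕ} {r : MonoidAlgebra K A} (hr : ∀ i ∈ augIdeal K A ^ m₀, r * i ∈ diagonalIdealK A M K)
    (hrP : Function.Surjective fun x : P => r • x) {x : P}
    (hx : x ∈ (augIdeal K A ^ m₀ • ⊤ : Submodule (MonoidAlgebra K A) P)) (y : P) :
    wedgeClass (actA A K P) x y = 0 := by
  induction hx using Submodule.smul_induction_on' with
  | smul i hi p _ =>
    -- Writing `p` as `r p'` turns `i p` into `(r i) p'` with `r i` in the diagonal ideal.
    obtain ⟨p, rfl⟩ := hrP p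
    rw [smul_smul, mul_comm]
    exact wedgeClass_diagonalIdealK_smul hP (hr i hi) p y
  | add x _ x' _ h h' => rw [wedgeClass_add_left, h, h', add_zero]

end Vanishing

/-! ### Truncation, completion and localization -/

section Truncation

variable {A : Type*} [CommGroup A] {K : Type*} [CommRing K]

/-- A finite geometric series inverts `r`: it divides `1 - (1 - r)^m`, which acts as the identity.
-/
theorem surjective_smul_of_pow_smul_eq_bot {Λ : Type*} [CommRing Λ] {I : Ideal Λ} {P : Type*}
    [AddCommGroup P] [Module Λ P] {m : ℕ} (h : (I ^ m • ⊤ : Submodule Λ P) = ⊥) {r : Λ}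
    (hr : r - 1 ∈ I) : Function.Surjective fun x : P => r • x := by
  intro x
  obtain ⟨q, hq⟩ := sub_dvd_pow_sub_pow 1 (1 - r) m
  refine ⟨q • x, ?_⟩
  have h1 : (1 - r) ^ m ∈ I ^ m := Ideal.pow_mem_pow (by simpa using I.neg_mem hr) m
  have h2 := Submodule.smul_mem_smul h1 (Submodule.mem_top (x := x))
  rw [h, Submodule.mem_bot] at h2
  rw [one_pow, sub_sub_cancel] at hq
  change r • q • x = x
  rw [smul_smul, ← hq, sub_smul, one_smul, h2, sub_zero]

theorem pow_smul_quotient_eq_bot {Λ : Type*} [CommRing Λ] (I : Ideal Λ) (N : Type*)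
    [AddCommGroup N] [Module Λ N] (m : ℕ) :
    (I ^ m • ⊤ : Submodule Λ (N ⧸ (I ^ m • ⊤ : Submodule Λ N))) = ⊥ := by
  rw [eq_bot_iff, Submodule.smul_le]
  intro i hi x _
  obtain ⟨x, rfl⟩ := Submodule.Quotient.mk_surjective _ x
  rw [← Submodule.Quotient.mk_smul, Submodule.mem_bot, Submodule.Quotient.mk_eq_zero]
  exact Submodule.smul_mem_smul hi Submodule.mem_top

section Annihilator

variable {M : Type*} [AddCommGroup M] [Module (MonoidAlgebra ℤ A) M]

theorem annihilator_smul_of_span {N : Type*} [AddCommGroup N] [Module (MonoidAlgebra K A) N]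
    (g : M →ₛₗ[grMap A (Int.castRingHom K)] N)
    (hg : Submodule.span (MonoidAlgebra K A) (Set.range g) = ⊤) {c : MonoidAlgebra ℤ A}
    (hc : c ∈ Module.annihilator (MonoidAlgebra ℤ A) M) (x : N) :
    grMap A (Int.castRingHom K) c • x = 0 := by
  have hx : x ∈ Submodule.span (MonoidAlgebra K A) (Set.range g) := hg ▸ Submodule.mem_top
  induction hx using Submodule.span_induction with
  | mem x hx =>
    obtain ⟨x, rfl⟩ := hx
    rw [← map_smulₛₗ, Module.mem_annihilator.1 hc, map_zero]
  | zero => rw [smul_zero]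
  | add x y _ _ hx hy => rw [smul_add, hx, hy, add_zero]
  | smul r x _ hx => rw [smul_comm, hx, smul_zero]

variable {c : MonoidAlgebra ℤ A} (hc : c ∈ Module.annihilator (MonoidAlgebra ℤ A) M)
include hc

theorem annihilator_smul_MK (x : MK A M K) : grMap A (Int.castRingHom K) c • x = 0 :=
  annihilator_smul_of_span _ (ExtendScalars.span_range_unit _) hc x

theorem annihilator_smul_truncMK (m : ℕ) (x : truncMK A M K m) :
    grMap A (Int.castRingHom K) c • x = 0 := by
  obtain ⟨x, rfl⟩ := Submodule.Quotient.mk_surjective _ x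
  rw [← Submodule.Quotient.mk_smul, annihilator_smul_MK hc, Submodule.Quotient.mk_zero]

theorem annihilator_smul_hatMK (x : hatMK A M K) : grMap A (Int.castRingHom K) c • x = 0 := by
  refine AdicCompletion.ext fun m => ?_
  exact annihilator_smul_truncMK hc m (x.val m)

theorem annihilator_smul_locMK [IsNoetherianRing (MonoidAlgebra K A)] (x : locMK A M K) :
    grMap A (Int.castRingHom K) c • x = 0 := by
  induction x using LocalizedModule.induction_on with
  | h x s => rw [LocalizedModule.smul'_mk, annihilator_smul_MK hc, LocalizedModule.zero_mk]

end Annihilator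

variable {M : Type*} [AddCommGroup M] [Module (MonoidAlgebra ℤ A) M]

/-- Once the kernel dies in the coinvariants, a class depends only on the images under `f`;
equivariance of `f` then matches the two actions. -/
theorem inducesIso_linearMap {P P' : Type*} [AddCommGroup P] [AddCommGroup P']
    [Module (MonoidAlgebra K A) P] [Module (MonoidAlgebra K A) P']
    (f : P →ₗ[MonoidAlgebra K A] P') (hf : Function.Surjective f)
    (hker : ∀ x, f x = 0 → ∀ y, wedgeClass (actA A K P) x y = 0) :
    InducesIso (actA A K P) (actA A K P') f := by
  refine inducesIso_of_surjective (actA A K P) (actA A K P') f.toAddMonoidHom hf hker ?_ ?_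
  · intro a x y
    change wedgeClass (actA A K P') (f (MonoidAlgebra.of K A a • x))
      (f (MonoidAlgebra.of K A a • y)) = _
    rw [map_smul, map_smul]
    exact wedgeClass_act (actA A K P') a _ _
  · intro a x y x' y' hx hy
    have h : ∀ z z' : P, f z' = MonoidAlgebra.of K A a • f z →
        ∀ w, wedgeClass (actA A K P) z' w =
          wedgeClass (actA A K P) (MonoidAlgebra.of K A a • z) w := by
      intro z z' hz w
      have h1 := hker (z' - MonoidAlgebra.of K A a • z) (by rw [map_sub, map_smul, hz, sub_self]) w
      rw [← wedgeHom_apply, map_sub, AddMonoidHom.sub_apply, sub_eq_zero] at h1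
      exact h1
    rw [h x x' hx, wedgeClass_swap, h y y' hy, ← wedgeClass_swap]
    exact wedgeClass_act (actA A K P) a x y

/-! ### Truncation, completion and localization have the same coinvariants. -/

section Bound

variable {m₀ : ℕ} {r : MonoidAlgebra K A} (hr1 : r - 1 ∈ augIdeal K A)
  (hr : ∀ i ∈ augIdeal K A ^ m₀, r * i ∈ diagonalIdealK A M K)
include hr1 hr

theorem wedgeClass_truncMK_eq_zero (m : ℕ) {x : truncMK A M K m}
    (hx : x ∈ (augIdeal K A ^ m₀ • ⊤ : Submodule (MonoidAlgebra K A) (truncMK A M K m)))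
    (y : truncMK A M K m) : wedgeClass (actA A K (truncMK A M K m)) x y = 0 :=
  wedgeClass_eq_zero_of_mem_pow_smul (fun _ hc => annihilator_smul_truncMK hc m) hr
    (surjective_smul_of_pow_smul_eq_bot (pow_smul_quotient_eq_bot _ _ m) hr1) hx y

variable [Group.FG A] [IsNoetherianRing K]

/-- Elements of `1 + I` act invertibly on the completion. Since `I` is finitely generated, the
kernel of the projection to the truncation is `I^m₀` times the completion, so the vanishing
criterion applies. -/
theorem wedgeClass_hatMK_eq_zero {x : hatMK A M K}
    (hx : AdicCompletion.eval (augIdeal K A) (MK A M K) m₀ x = 0) (y : hatMK A M K) :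
    wedgeClass (actA A K (hatMK A M K)) x y = 0 := by
  refine wedgeClass_eq_zero_of_mem_pow_smul (fun _ hc => annihilator_smul_hatMK hc) hr ?_ ?_ y
  · exact ((Module.End.isUnit_iff _).1
      (isUnit_end_completion (augIdeal K A) (MK A M K) ⟨r, hr1⟩)).2
  · rw [AdicCompletion.pow_smul_top_eq_ker_eval (IsNoetherian.noetherian _)]
    exact hx

theorem inducesIso_eval {m : ℕ} (hm : m₀ ≤ m) :
    InducesIso (actA A K (hatMK A M K)) (actA A K (truncMK A M K m))
      (AdicCompletion.eval (augIdeal K A) (MK A M K) m) := by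
  refine inducesIso_linearMap _ (AdicCompletion.eval_surjective _ _ m) fun x hx y =>
    wedgeClass_hatMK_eq_zero hr1 hr ?_ y
  have h := LinearMap.congr_fun
    (AdicCompletion.transitionMap_comp_eval (augIdeal K A) (MK A M K) hm) x
  rw [← h, LinearMap.comp_apply, hx, map_zero]

/-- The map to the completion need not be surjective, but its composite with the projection to `M_K
/ M_K I^m₀` is, so both sides are compared with this truncation. -/
theorem inducesIso_locToCompletion :
    InducesIso (actA A K (locMK A M K)) (actA A K (hatMK A M K))
      (locToCompletion (augIdeal K A) (MK A M K)) := by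
  refine InducesIso.of_comp (inducesIso_eval hr1 hr le_rfl) ?_
  have hloc : ∀ x : MK A M K, locToCompletion (augIdeal K A) (MK A M K) (LocalizedModule.mk x 1) =
      AdicCompletion.of (augIdeal K A) (MK A M K) x := by
    intro x
    exact LinearMap.congr_fun (LocalizedModule.lift_comp (onePlus (augIdeal K A))
      (AdicCompletion.of (augIdeal K A) (MK A M K)) (isUnit_end_completion _ _)) x
  refine inducesIso_linearMap ((AdicCompletion.eval (augIdeal K A) (MK A M K) m₀).comp
    (locToCompletion (augIdeal K A) (MK A M K))) ?_ ?_
  · intro x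
    obtain ⟨x, rfl⟩ := Submodule.Quotient.mk_surjective _ x
    refine ⟨LocalizedModule.mk x 1, ?_⟩
    rw [LinearMap.comp_apply, hloc, AdicCompletion.eval_of]
    rfl
  · intro x hx y
    refine wedgeClass_eq_zero_of_mem_pow_smul (fun _ hc => annihilator_smul_locMK hc) hr ?_ ?_ y
    · intro z
      induction z using LocalizedModule.induction_on with
      | h z s =>
        refine ⟨LocalizedModule.mk z (⟨r, hr1⟩ * s), ?_⟩
        change r • LocalizedModule.mk z _ = _
        rw [LocalizedModule.smul'_mk]
        exact LocalizedModule.mk_cancel_common_left (⟨r, hr1⟩ : onePlus (augIdeal K A)) s z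
    · induction x using LocalizedModule.induction_on with
      | h x s =>
        -- Clearing the denominator shows that the numerator of an element of the kernel lies in
        -- `I^m₀ M_K`.
        have h1 : (s : MonoidAlgebra K A) • LocalizedModule.mk x s = LocalizedModule.mk x 1 := by
          rw [LocalizedModule.smul'_mk]
          have := LocalizedModule.mk_cancel_common_left s 1 x
          rwa [mul_one] at this
        have h2 : AdicCompletion.eval (augIdeal K A) (MK A M K) m₀
            (locToCompletion (augIdeal K A) (MK A M K) (LocalizedModule.mk x 1)) = 0 := by
          rw [← h1, map_smul, map_smul]
          rw [LinearMap.comp_apply] at hx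
          rw [hx, smul_zero]
        rw [hloc, AdicCompletion.eval_of] at h2
        have h3 : x ∈ (augIdeal K A ^ m₀ • ⊤ : Submodule (MonoidAlgebra K A) (MK A M K)) :=
          (Submodule.Quotient.mk_eq_zero _).1 h2
        clear hx h1 h2
        induction h3 using Submodule.smul_induction_on' with
        | smul i hi z _ =>
          rw [← LocalizedModule.smul'_mk]
          exact Submodule.smul_mem_smul hi Submodule.mem_top
        | add z _ z' _ h h' =>
          have := Submodule.add_mem _ h h'
          rwa [LocalizedModule.mk_add_mk, ← smul_add, LocalizedModule.mk_cancel_common_left] at this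

end Bound

end Truncation

/-! ### Actions through the completed group ring -/

section CompletedAction

variable {Λ : Type*} [CommRing Λ] {I : Ideal Λ}

theorem val_eq_of_evalₐ_eq {m : ℕ} {t : AdicCompletion I Λ} {l : Λ}
    (h : AdicCompletion.evalₐ I m t = Ideal.Quotient.mk (I ^ m) l) :
    t.val m = Ideal.Quotient.mk (I ^ m • ⊤ : Ideal Λ) l := by
  have hI : (I ^ m • ⊤ : Ideal Λ) = I ^ m := by ext x; simp
  rw [← AdicCompletion.evalₐ_of] at h
  exact (Ideal.quotientEquivAlgOfEq Λ hI).injective h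

theorem evalₐ_eq_of_val_eq {m : ℕ} {t : AdicCompletion I Λ} {l : Λ}
    (h : t.val m = Ideal.Quotient.mk (I ^ m • ⊤ : Ideal Λ) l) :
    AdicCompletion.evalₐ I m t = Ideal.Quotient.mk (I ^ m) l := by
  have hI : (I ^ m • ⊤ : Ideal Λ) = I ^ m := by ext x; simp
  rw [← AdicCompletion.evalₐ_of]
  exact congrArg (Ideal.quotientEquivAlgOfEq Λ hI) h

theorem eval_smul_of_evalₐ_eq {N : Type*} [AddCommGroup N] [Module Λ N] {m : ℕ}
    {t : AdicCompletion I Λ} {l : Λ}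
    (h : AdicCompletion.evalₐ I m t = Ideal.Quotient.mk (I ^ m) l) (x : AdicCompletion I N) :
    AdicCompletion.eval I N m (t • x) = l • AdicCompletion.eval I N m x := by
  change (t • x).val m = l • x.val m
  rw [AdicCompletion.smul_eval, val_eq_of_evalₐ_eq h]
  obtain ⟨y, hy⟩ := Submodule.Quotient.mk_surjective _ (x.val m)
  rw [← hy]
  rfl

/-- On a module killed by `I^m` the completed ring acts through `Λ / I^m`, so any representative `l`
gives the action. -/
theorem actionViaCompletion_apply {H : Type*} [Monoid H] {N : Type*} [AddCommGroup N] [Module Λ N]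
    [IsAdicComplete I N] (θ : H →* AdicCompletion I Λ) {m : ℕ}
    (hN : (I ^ m • ⊤ : Submodule Λ N) = ⊥) {g : H} {l : Λ}
    (h : AdicCompletion.evalₐ I m (θ g) = Ideal.Quotient.mk (I ^ m) l) (x : N) :
    actionViaCompletion θ N g x = l • x := by
  set z := actionViaCompletion θ N g x with hz
  have h1 : AdicCompletion.of I N z = θ g • AdicCompletion.of I N x := by
    rw [hz]
    exact AdicCompletion.of_ofLinearEquiv_symm I _
  have h2 := congrArg (AdicCompletion.eval I N m) h1
  rw [eval_smul_of_evalₐ_eq h, AdicCompletion.eval_of, AdicCompletion.eval_of, ← map_smul,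
    Submodule.mkQ_apply, Submodule.mkQ_apply, Submodule.Quotient.eq, hN, Submodule.mem_bot,
    sub_eq_zero] at h2
  exact h2

theorem evalₐ_completionMap {Λ' : Type*} [CommRing Λ'] {I' : Ideal Λ'} (f : Λ →+* Λ')
    (hf : I ≤ I'.comap f) (m : ℕ) (t : AdicCompletion I Λ) :
    AdicCompletion.evalₐ I' m (completionMap I I' f hf t) =
      Ideal.quotientMap (I' ^ m) f
        ((Ideal.pow_right_mono hf m).trans (Ideal.le_comap_pow f m))
        (AdicCompletion.evalₐ I m t) := by
  refine AdicCompletion.evalₐ_liftRingHom _ _ ?_ _ _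
  intro i j hij
  ext x
  obtain ⟨x, rfl⟩ := AdicCompletion.mk_surjective I Λ x
  simp only [RingHom.comp_apply, AlgHom.toRingHom_eq_coe, RingHom.coe_coe,
    AdicCompletion.evalₐ_mk, Ideal.quotientMap_mk, Ideal.Quotient.factor_mk]
  have h := congrArg (Ideal.quotientMap (I' ^ i) f
    ((Ideal.pow_right_mono hf i).trans (Ideal.le_comap_pow f i)))
    (AdicCompletion.Ideal.mk_eq_mk I hij x)
  simpa using h

theorem evalₐ_completionMap_of_eq {Λ' : Type*} [CommRing Λ'] {I' : Ideal Λ'} (f : Λ →+* Λ')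
    (hf : I ≤ I'.comap f) {m : ℕ} {t : AdicCompletion I Λ} {l : Λ}
    (h : AdicCompletion.evalₐ I m t = Ideal.Quotient.mk (I ^ m) l) :
    AdicCompletion.evalₐ I' m (completionMap I I' f hf t) = Ideal.Quotient.mk (I' ^ m) (f l) := by
  rw [evalₐ_completionMap, h, Ideal.quotientMap_mk]

theorem evalₐ_algebraMap (m : ℕ) (l : Λ) :
    AdicCompletion.evalₐ I m (algebraMap Λ _ l) = Ideal.Quotient.mk (I ^ m) l := by
  rw [AlgHom.commutes]
  rfl

/-- The extended ideal maps into the image of `I'` modulo `I'^m`; for `m ≠ 0` one has `I'^m ⊆ I'`,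
so membership lifts to the representative. -/
theorem sub_one_mem_of_evalₐ_completionMap {Λ' : Type*} [CommRing Λ'] {I' : Ideal Λ'} (f : Λ →+* Λ')
    (hf : I ≤ I'.comap f) {u : AdicCompletion I Λ}
    (hu : u - 1 ∈ I.map (algebraMap Λ (AdicCompletion I Λ))) {m : ℕ} (hm : m ≠ 0) {l : Λ'}
    (hl : AdicCompletion.evalₐ I' m (completionMap I I' f hf u) = Ideal.Quotient.mk _ l) :
    l - 1 ∈ I' := by
  let q := (AdicCompletion.evalₐ I' m).toRingHom.comp (completionMap I I' f hf)
  have hq : ∀ u, q u = AdicCompletion.evalₐ I' m (completionMap I I' f hf u) := fun _ => rfl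
  have hle : I.map (algebraMap Λ (AdicCompletion I Λ)) ≤
      (I'.map (Ideal.Quotient.mk (I' ^ m))).comap q := by
    rw [Ideal.map_le_iff_le_comap]
    intro x hx
    rw [Ideal.mem_comap, Ideal.mem_comap, hq, evalₐ_completionMap_of_eq _ _ (evalₐ_algebraMap m x)]
    exact Ideal.mem_map_of_mem _ (hf hx)
  have h2 := hle hu
  rw [Ideal.mem_comap, map_sub, map_one, hq, hl, ← map_one (Ideal.Quotient.mk (I' ^ m)),
    ← map_sub, Ideal.mem_map_iff_of_surjective _ Ideal.Quotient.mk_surjective] at h2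
  obtain ⟨i, hi, hil⟩ := h2
  rw [Ideal.Quotient.eq] at hil
  have := Ideal.sub_mem _ hi (Ideal.pow_le_self hm hil)
  rwa [sub_sub_cancel] at this

/-- Modulo powers of `I`, an element of `1 + I` is determined by its `s`-th power if `s` is
invertible. -/
theorem sub_one_mem_pow_of_pow_sub_one_mem {s : ℕ} (hs : IsUnit (s : Λ)) {x : Λ}
    (hx : x - 1 ∈ I) {m : ℕ} (hxs : x ^ s - 1 ∈ I ^ m) : x - 1 ∈ I ^ m := by
  obtain ⟨u, hu⟩ := hs
  set g := ∑ i ∈ Finset.range s, x ^ i with hg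
  have hgs : (s : Λ) - g ∈ I := by
    have : (s : Λ) - g = -∑ i ∈ Finset.range s, (x ^ i - 1) := by
      rw [Finset.sum_sub_distrib, hg]
      simp
    rw [this]
    exact I.neg_mem (Ideal.sum_mem _ fun i _ =>
      Ideal.mem_of_dvd _ (sub_one_dvd_pow_sub_one x i) hx)
  -- As `x ≡ 1`, the geometric sum `g` is congruent to `s`, so `e = 1 - g/s` lies in `I`. From `(1 -
  -- e)(x - 1) ∈ I^m` one gets `(1 - e^m)(x - 1) ∈ I^m`, and `e^m ∈ I^m`.
  set e : Λ := ((u⁻¹ : Λˣ) : Λ) * (s - g) with he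
  have he1 : 1 - e = ((u⁻¹ : Λˣ) : Λ) * g := by
    rw [he, mul_sub, ← hu, Units.inv_mul]
    ring
  have h1 : (1 - e) * (x - 1) ∈ I ^ m := by
    rw [he1, mul_assoc, geom_sum_mul]
    exact Ideal.mul_mem_left _ _ hxs
  obtain ⟨q, hq⟩ := sub_dvd_pow_sub_pow 1 e m
  have h2 : (1 ^ m - e ^ m) * (x - 1) ∈ I ^ m := by
    rw [hq, mul_comm (1 - e) q, mul_assoc]
    exact Ideal.mul_mem_left _ _ h1
  have h3 : e ^ m * (x - 1) ∈ I ^ m :=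
    Ideal.mul_mem_right _ _ (Ideal.pow_mem_pow (Ideal.mul_mem_left _ _ hgs) m)
  have := Ideal.add_mem _ h2 h3
  rwa [one_pow, ← add_mul, sub_add_cancel, one_mul] at this

end CompletedAction

/-- A homomorphism `θ` to the completed group ring that extends the map from `A` and whose values
are unitary for the involution, modulo every power of the augmentation ideal. -/
structure IsUnitaryExtension {A K H : Type*} [CommGroup A] [CommRing K] [Monoid H]
    (θ : H →* AdicCompletion (augIdeal K A) (MonoidAlgebra K A)) : Prop where
  extends_of : ∀ a : A, ∃ h, ∀ m, AdicCompletion.evalₐ (augIdeal K A) m (θ h) =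
    Ideal.Quotient.mk _ (MonoidAlgebra.of K A a)
  unitary : ∀ h m, ∃ l : MonoidAlgebra K A,
    AdicCompletion.evalₐ (augIdeal K A) m (θ h) = Ideal.Quotient.mk _ l ∧
      involution K A l * l - 1 ∈ augIdeal K A ^ m

/-! ### Unitary elements preserve wedge classes. -/

section Unitary

variable {A : Type*} [CommGroup A] {K : Type*} [CommRing K]
  {M : Type*} [AddCommGroup M] [Module (MonoidAlgebra ℤ A) M]
  {H : Type*} [Monoid H] {θ : H →* AdicCompletion (augIdeal K A) (MonoidAlgebra K A)}
  {m₀ : ℕ} {r : MonoidAlgebra K A}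

/-- Moving `l` across gives `l x ∧ l y = x ∧ (l* l) y`, and `(l* l - 1) y` lies in `I^m P`, which
the wedge ignores. -/
theorem wedgeClass_smul_smul_of_unitary (hK : HasIntFractions K) {P : Type*} [AddCommGroup P]
    [Module (MonoidAlgebra K A) P] {m : ℕ} {l : MonoidAlgebra K A}
    (hl : involution K A l * l - 1 ∈ augIdeal K A ^ m)
    (hP : ∀ x ∈ (augIdeal K A ^ m • ⊤ : Submodule (MonoidAlgebra K A) P), ∀ y,
      wedgeClass (actA A K P) x y = 0) (x y : P) :
    wedgeClass (actA A K P) (l • x) (l • y) = wedgeClass (actA A K P) x y := by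
  rw [wedgeClass_smul_left hK, smul_smul]
  have h := hP _ (Submodule.smul_mem_smul hl (Submodule.mem_top (x := y))) x
  rw [sub_smul, one_smul, ← wedgeHom_apply, map_sub, AddMonoidHom.sub_apply, sub_eq_zero,
    wedgeHom_apply, wedgeHom_apply] at h
  rw [wedgeClass_swap, h, ← wedgeClass_swap]

/-- Modulo `I^m₀`, which the wedge does not see, `θ h` is a unitary `l ∈ K[A]`; this gives one
inclusion. The other holds because the action of `A` is a part of the action through `θ`. -/
theorem coinvariants_ker_actionVia_hatMK [Group.FG A] [IsNoetherianRing K]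
    (hr1 : r - 1 ∈ augIdeal K A)
    (hr : ∀ i ∈ augIdeal K A ^ m₀, r * i ∈ diagonalIdealK A M K) (hK : HasIntFractions K)
    (hθ : IsUnitaryExtension θ) :
    Representation.Coinvariants.ker (extSq (actionVia θ (hatMK A M K))) =
      Representation.Coinvariants.ker (extSq (actA A K (hatMK A M K))) := by
  refine le_antisymm (coinvariants_ker_le _ _ fun h x y => ?_) (coinvariants_ker_le _ _
    fun a x y => ?_)
  · obtain ⟨l, hl, hl1⟩ := hθ.unitary h m₀
    have key : ∀ x y : hatMK A M K, wedgeClass (actA A K (hatMK A M K)) (θ h • x) y =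
        wedgeClass (actA A K (hatMK A M K)) (l • x) y := by
      intro x y
      have h1 := wedgeClass_hatMK_eq_zero hr1 hr (x := θ h • x - l • x)
        (by rw [map_sub, eval_smul_of_evalₐ_eq hl, map_smul, sub_self]) y
      rw [← wedgeHom_apply, map_sub, AddMonoidHom.sub_apply, sub_eq_zero] at h1
      exact h1
    change wedgeClass _ (θ h • x) (θ h • y) = _
    rw [key, wedgeClass_swap, key, ← wedgeClass_swap]
    refine wedgeClass_smul_smul_of_unitary hK hl1 (fun z hz w => ?_) x y
    refine wedgeClass_hatMK_eq_zero hr1 hr ?_ w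
    rw [AdicCompletion.pow_smul_top_eq_ker_eval (IsNoetherian.noetherian _)] at hz
    exact hz
  · obtain ⟨h, hh⟩ := hθ.extends_of a
    have key : ∀ x : hatMK A M K, actA A K (hatMK A M K) a x = actionVia θ (hatMK A M K) h x := by
      intro x
      refine AdicCompletion.ext fun m => ?_
      exact (eval_smul_of_evalₐ_eq (hh m) x).symm
    rw [key, key]
    exact wedgeClass_act (actionVia θ (hatMK A M K)) h x y

/-- The larger group acts only on the target. Each of its elements acts there as some `l ∈ K[A]`,
and `l` acts on the source compatibly with `f`; unitarity makes this lifted action invisible to the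
wedge. -/
theorem inducesIso_truncMK_of_lifts {H' : Type*} [Monoid H']
    (hr1 : r - 1 ∈ augIdeal K A)
    (hr : ∀ i ∈ augIdeal K A ^ m₀, r * i ∈ diagonalIdealK A M K) (hK : HasIntFractions K)
    {m : ℕ} (hm : m₀ ≤ m) {N : Type*} [AddCommGroup N] [Module (MonoidAlgebra K A) N]
    (ρ : Representation ℤ H' N) (f : truncMK A M K m →ₗ[MonoidAlgebra K A] N)
    (hf : Function.Surjective f)
    (hker : ∀ x, f x = 0 →
      x ∈ (augIdeal K A ^ m₀ • ⊤ : Submodule (MonoidAlgebra K A) (truncMK A M K m)))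
    (hρ : ∀ a : A, ∃ h, ∀ x, ρ h x = MonoidAlgebra.of K A a • x)
    (hρ' : ∀ h, ∃ l : MonoidAlgebra K A, (∀ x, ρ h x = l • x) ∧
      involution K A l * l - 1 ∈ augIdeal K A ^ m) :
    InducesIso (actA A K (truncMK A M K m)) ρ f := by
  have h0 : ∀ x ∈ (augIdeal K A ^ m₀ • ⊤ : Submodule (MonoidAlgebra K A) (truncMK A M K m)),
      ∀ y, wedgeClass (actA A K (truncMK A M K m)) x y = 0 :=
    fun x hx y => wedgeClass_truncMK_eq_zero hr1 hr m hx y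
  refine inducesIso_of_surjective _ _ f.toAddMonoidHom hf (fun x hx => h0 x (hker x hx)) ?_ ?_
  · intro a x y
    obtain ⟨h, hh⟩ := hρ a
    change wedgeClass ρ (f (MonoidAlgebra.of K A a • x)) (f (MonoidAlgebra.of K A a • y)) = _
    rw [map_smul, map_smul, ← hh, ← hh]
    exact wedgeClass_act ρ h _ _
  · intro h x y x' y' hx hy
    obtain ⟨l, hl, hl1⟩ := hρ' h
    have key : ∀ z z', f z' = ρ h (f z) → ∀ w, wedgeClass (actA A K (truncMK A M K m)) z' w =
        wedgeClass (actA A K (truncMK A M K m)) (l • z) w := by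
      intro z z' hz w
      have h1 := h0 (z' - l • z) (hker _ (by rw [map_sub, map_smul, hz, hl, sub_self])) w
      rw [← wedgeHom_apply, map_sub, AddMonoidHom.sub_apply, sub_eq_zero] at h1
      exact h1
    rw [key x x' hx, wedgeClass_swap, key y y' hy, ← wedgeClass_swap]
    exact wedgeClass_smul_smul_of_unitary hK hl1
      (fun z hz => h0 z (Submodule.smul_mono_left (Ideal.pow_le_pow_right hm) hz)) x y

end Unitary

/-! ### The homomorphisms `θ_R` are unitary extensions of the map from `A`. -/

section ThetaUnitary

variable {A : Type*} [CommGroup A]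

theorem exists_nat_of_mem_multSet {J : Set ℕ} {s : ℤ} (hs : s ∈ multSet J) :
    ∃ n : ℕ, (n : ℤ) = s := by
  induction hs using Submonoid.closure_induction with
  | mem s hs =>
    obtain ⟨p, -, rfl⟩ := hs
    exact ⟨p, rfl⟩
  | one => exact ⟨1, rfl⟩
  | mul s t _ _ hs ht =>
    obtain ⟨m, rfl⟩ := hs
    obtain ⟨n, rfl⟩ := ht
    exact ⟨m * n, by push_cast; rfl⟩

theorem hasIntFractions_of_ZInv (J : Set ℕ) {K : Type*} [CommRing K] [Algebra (ZInv J) K]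
    (h : Function.Surjective (algebraMap (ZInv J) K)) : HasIntFractions K := by
  intro k
  obtain ⟨z, rfl⟩ := h k
  obtain ⟨⟨t, s⟩, hst⟩ := IsLocalization.surj (multSet J) z
  have hs := (IsLocalization.map_units (ZInv J) s).map (algebraMap (ZInv J) K)
  have hst' := congrArg (algebraMap (ZInv J) K) hst
  have hc : ∀ i : ℤ, algebraMap (ZInv J) K (algebraMap ℤ (ZInv J) i) = i := fun i =>
    eq_intCast ((algebraMap (ZInv J) K).comp (algebraMap ℤ (ZInv J))) i
  rw [hc] at hs
  rw [map_mul, hc, hc] at hst'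
  exact ⟨s, t, hs, by rw [mul_comm]; exact hst'⟩

theorem hasIntFractions_of_ZMod (n : ℕ) {K : Type*} [CommRing K] [Algebra (ZMod n) K]
    (h : Function.Surjective (algebraMap (ZMod n) K)) : HasIntFractions K := by
  intro k
  obtain ⟨z, rfl⟩ := h k
  obtain ⟨t, rfl⟩ := ZMod.intCast_surjective z
  exact ⟨1, t, by simp, by simp⟩

section

variable [Group.FG A] (J : Set ℕ)

theorem thetaZ_one_tmul (a : A) :
    thetaZ J A (Multiplicative.ofAdd ((1 : ZInv J) ⊗ₜ[ℤ] Additive.ofMul a)) =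
      algebraMap _ _ (MonoidAlgebra.of (ZInv J) A a) := by
  have h1 : thetaTilde J A ((1 : ZInv J) ⊗ₜ[ℤ] Additive.ofMul a) =
      Additive.ofMul (toPrincipalUnits J A a) :=
    IsLocalizedModule.lift_apply (multSet J) (TensorProduct.mk ℤ (ZInv J) (Additive A) 1)
      (MonoidHom.toAdditive (toPrincipalUnits J A)).toIntLinearMap
      (isUnit_end_principalUnits J A) (Additive.ofMul a)
  change (((thetaTilde J A ((1 : ZInv J) ⊗ₜ[ℤ] Additive.ofMul a)).toMul :
    (complZ J A)ˣ) : complZ J A) = _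
  rw [h1]
  rfl

theorem thetaZ_sub_one_mem (h : Multiplicative (ZInv J ⊗[ℤ] Additive A)) :
    thetaZ J A h - 1 ∈ complZIdeal J A := by
  have key : ∀ x : principalUnits (complZIdeal J A),
      (((x : (complZ J A)ˣ)) : complZ J A) - 1 ∈ complZIdeal J A :=
    fun x => (mem_principalUnits _ _).1 x.2
  exact key (thetaTilde J A h.toAdd).toMul

variable (K : Type*) [CommRing K] [Algebra (ZInv J) K]

theorem evalₐ_thetaKZ_one_tmul (a : A) (m : ℕ) :
    AdicCompletion.evalₐ (augIdeal K A) m (thetaKZ (A := A) J K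
      (Multiplicative.ofAdd ((1 : ZInv J) ⊗ₜ[ℤ] Additive.ofMul a))) =
      Ideal.Quotient.mk _ (MonoidAlgebra.of K A a) := by
  change AdicCompletion.evalₐ (augIdeal K A) m (completionMap (augIdeal (ZInv J) A) (augIdeal K A)
    (grMap A (algebraMap (ZInv J) K)) (augIdeal_le_comap A _) (thetaZ J A _)) = _
  rw [thetaZ_one_tmul, evalₐ_completionMap_of_eq _ _ (evalₐ_algebraMap m _)]
  congr 1
  simp [MonoidAlgebra.of_apply]

theorem sub_one_mem_augIdeal_of_evalₐ_thetaKZ (h : Multiplicative (ZInv J ⊗[ℤ] Additive A))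
    {m : ℕ} (hm : m ≠ 0) {l : MonoidAlgebra K A}
    (hl : AdicCompletion.evalₐ (augIdeal K A) m (thetaKZ J K h) = Ideal.Quotient.mk _ l) :
    l - 1 ∈ augIdeal K A := by
  exact sub_one_mem_of_evalₐ_completionMap _ (augIdeal_le_comap A _) (thetaZ_sub_one_mem J h) hm hl

/-- Some power `h ^ n`, with `n` invertible in `K`, comes from `a ∈ A`. Modulo `I^m` a
representative `l` of `θ h` then satisfies `(l* l)^n ≡ a⁻¹ a = 1`, and unique `n`-divisibility of `1
+ I` gives `l* l ≡ 1`. -/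
theorem isUnitaryExtension_thetaKZ : IsUnitaryExtension (thetaKZ (A := A) J K) := by
  refine ⟨fun a => ⟨_, evalₐ_thetaKZ_one_tmul J K a⟩, fun h m => ?_⟩
  -- For `m = 0` an arbitrary representative need not lie in `1 + I`; the quotient is trivial, so
  -- `1` is chosen.
  rcases eq_or_ne m 0 with rfl | hm
  · have : Subsingleton (MonoidAlgebra K A ⧸ augIdeal K A ^ 0) := by
      rw [pow_zero, Ideal.one_eq_top]
      exact Ideal.Quotient.subsingleton_iff.2 rfl
    exact ⟨1, Subsingleton.elim _ _, by simp⟩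
  obtain ⟨l, hl⟩ := Ideal.Quotient.mk_surjective
    (AdicCompletion.evalₐ (augIdeal K A) m (thetaKZ J K h))
  have hl1 := sub_one_mem_augIdeal_of_evalₐ_thetaKZ J K h hm hl.symm
  refine ⟨l, hl.symm, ?_⟩
  obtain ⟨⟨a, s⟩, has⟩ := IsLocalizedModule.surj (multSet J)
    (TensorProduct.mk ℤ (ZInv J) (Additive A) 1) h.toAdd
  obtain ⟨n, hn⟩ := exists_nat_of_mem_multSet s.2
  have hunit : IsUnit (n : MonoidAlgebra K A) := by
    have h1 := ((IsLocalization.map_units (ZInv J) s).map (algebraMap (ZInv J) K)).map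
      (algebraMap K (MonoidAlgebra K A))
    rwa [← hn, eq_intCast, Int.cast_natCast, map_natCast, map_natCast] at h1
  have hpow : h ^ n = Multiplicative.ofAdd ((1 : ZInv J) ⊗ₜ[ℤ] a) := by
    have h1 : (n : ℤ) • h.toAdd = (1 : ZInv J) ⊗ₜ[ℤ] a := by
      rw [hn]
      exact has
    rw [Nat.cast_smul_eq_nsmul ℤ] at h1
    exact congrArg Multiplicative.ofAdd h1
  have hln : l ^ n - MonoidAlgebra.of K A a.toMul ∈ augIdeal K A ^ m := by
    rw [← Ideal.Quotient.eq, map_pow, hl, ← map_pow, ← map_pow, hpow]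
    exact evalₐ_thetaKZ_one_tmul J K a.toMul m
  have hσ : ∀ (j : ℕ) {x}, x ∈ augIdeal K A ^ j → involution K A x ∈ augIdeal K A ^ j := by
    intro j x hx
    exact (Ideal.pow_right_mono augIdeal_le_comap_involution j).trans
      (Ideal.le_comap_pow (involution K A) j) hx
  refine sub_one_mem_pow_of_pow_sub_one_mem hunit ?_ ?_
  · have h1 := hσ 1 (by simpa using hl1)
    rw [pow_one, map_sub, map_one] at h1
    have : involution K A l * l - 1 = involution K A l * (l - 1) + (involution K A l - 1) := by
      ring
    rw [this]
    exact Ideal.add_mem _ (Ideal.mul_mem_left _ _ hl1) h1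
  · have h1 := hσ m hln
    rw [map_sub, map_pow, involution_of] at h1
    have h2 : MonoidAlgebra.of K A a.toMul⁻¹ * MonoidAlgebra.of K A a.toMul = 1 := by
      rw [← map_mul, inv_mul_cancel, map_one]
    have : (involution K A l * l) ^ n - 1 =
        involution K A l ^ n * (l ^ n - MonoidAlgebra.of K A a.toMul) +
        MonoidAlgebra.of K A a.toMul * (involution K A l ^ n - MonoidAlgebra.of K A a.toMul⁻¹) := by
      linear_combination h2
    rw [this]
    exact Ideal.add_mem _ (Ideal.mul_mem_left _ _ hln) (Ideal.mul_mem_left _ _ h1)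

end

theorem idealS_le_comap (n : ℕ) (K : Type*) [CommRing K] [Algebra (ZMod n) K] :
    idealS n A ≤ (augIdeal K A).comap (grMap A ((algebraMap (ZMod n) K).comp (toZMod n))) := by
  intro x hx
  rw [idealS, RingHom.mem_ker, RingHom.comp_apply] at hx
  rw [Ideal.mem_comap, augIdeal, RingHom.mem_ker, augmentation_grMap, RingHom.comp_apply, hx,
    map_zero]

/-- Modulo `I^m` an element of the inverse limit acts as a representative `a ∈ A` of its `m`-th
component, and elements of `A` are unitary. -/
theorem isUnitaryExtension_thetaKMod (n : ℕ) (K : Type*) [CommRing K] [Algebra (ZMod n) K] :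
    IsUnitaryExtension (thetaKMod (A := A) n K) := by
  have key : ∀ (x : hatMod n A) m a, x.1 m = QuotientGroup.mk a →
      AdicCompletion.evalₐ (augIdeal K A) m (thetaKMod n K x) =
        Ideal.Quotient.mk _ (MonoidAlgebra.of K A a) := by
    intro x m a hx
    have h1 : AdicCompletion.evalₐ (idealS n A) m (thetaMod n A x) =
        Ideal.Quotient.mk _ (MonoidAlgebra.of (SMod n) A a) := by
      refine evalₐ_eq_of_val_eq ?_
      change thetaModLevel n A m (x.1 m) = _
      rw [hx]
      rfl
    refine (evalₐ_completionMap_of_eq _ (idealS_le_comap n K) h1).trans ?_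
    congr 1
    simp [MonoidAlgebra.of_apply]
  refine ⟨fun a => ⟨⟨fun _ => QuotientGroup.mk a, fun _ => rfl⟩, fun m => key _ m a rfl⟩,
    fun x m => ?_⟩
  obtain ⟨a, ha⟩ := QuotientGroup.mk_surjective (x.1 m)
  refine ⟨_, key x m a ha.symm, ?_⟩
  rw [involution_of, ← map_mul, inv_mul_cancel, map_one, sub_self]
  exact Ideal.zero_mem _

end ThetaUnitary

/-! ### The lower central series -/

section Series

variable {A : Type*} [CommGroup A] {M : Type*} [AddCommGroup M] [Module (MonoidAlgebra ℤ A) M]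
  {G : Type*} [Group G] (D : Decomposition A M G)

/-- The image in `G` of a submodule of `M`. -/
def Decomposition.image (S : Submodule (MonoidAlgebra ℤ A) M) : Subgroup G :=
  (AddSubgroup.toSubgroup S.toAddSubgroup).map D.ι

theorem Decomposition.mem_image {S : Submodule (MonoidAlgebra ℤ A) M} {g : G} :
    g ∈ D.image S ↔ ∃ x ∈ S, D.ι (Multiplicative.ofAdd x) = g :=
  Iff.rfl

theorem Decomposition.ι_mem_image {S : Submodule (MonoidAlgebra ℤ A) M} {x : M} :
    D.ι (Multiplicative.ofAdd x) ∈ D.image S ↔ x ∈ S := by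
  rw [D.mem_image]
  refine ⟨fun ⟨y, hy, h⟩ => ?_, fun h => ⟨x, h, rfl⟩⟩
  have := Multiplicative.ofAdd.injective (D.ι_injective h)
  rwa [← this]

theorem Decomposition.conj' (g : G) (x : M) :
    g * D.ι (Multiplicative.ofAdd x) * g⁻¹ =
      D.ι (Multiplicative.ofAdd (MonoidAlgebra.of ℤ A (π D g)⁻¹ • x)) := by
  have := D.conj g⁻¹ x
  rw [inv_inv, map_inv] at this
  exact this.symm

instance (S : Submodule (MonoidAlgebra ℤ A) M) : (D.image S).Normal where
  conj_mem := by
    rintro _ ⟨x, hx, rfl⟩ g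
    exact (D.conj' g x.toAdd).symm ▸ D.ι_mem_image.2 (Submodule.smul_mem _ _ hx)

theorem Decomposition.image_top : D.image ⊤ = D.π.ker := by
  rw [← D.exact]
  ext g
  exact ⟨fun ⟨x, _, h⟩ => ⟨x, h⟩, fun ⟨x, h⟩ => ⟨x, trivial, h⟩⟩

/-- The commutator of `ι x` and `g` is `ι` of `(1 - a⁻¹) x`, where `a = π g`. -/
theorem Decomposition.commutator_image_le {S T : Submodule (MonoidAlgebra ℤ A) M}
    (h : ∀ a : A, ∀ x ∈ S, (MonoidAlgebra.of ℤ A a - 1) • x ∈ T) :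
    ⁅D.image S, (⊤ : Subgroup G)⁆ ≤ D.image T := by
  rw [Subgroup.commutator_le]
  rintro _ ⟨x, hx, rfl⟩ g -
  rw [commutatorElement_def, mul_assoc, mul_assoc, ← mul_assoc g, ← map_inv]
  refine D.mem_image.2 ⟨x.toAdd - MonoidAlgebra.of ℤ A (D.π g)⁻¹ • x.toAdd, ?_, ?_⟩
  · have := T.neg_mem (h (D.π g)⁻¹ x.toAdd hx)
    rwa [sub_smul, one_smul, neg_sub] at this
  · have h1 := D.conj' g (-x.toAdd)
    rw [smul_neg] at h1
    rw [sub_eq_add_neg, ofAdd_add, map_mul, ← h1]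
    rfl

/-- The first commutator only brings `G` into `M`, since `A` is abelian; each further one gains a
factor of the augmentation ideal. -/
theorem Decomposition.lowerCentralSeries_le (j : ℕ) :
    (⊤ : Subgroup G).lowerCentralSeries (j + 1) ≤ D.image (augIdeal ℤ A ^ j • ⊤) := by
  induction j with
  | zero =>
    rw [pow_zero, Submodule.one_smul, D.image_top]
    change ⁅(⊤ : Subgroup G), ⊤⁆ ≤ _
    rw [Subgroup.commutator_le]
    intro g _ h _
    rw [MonoidHom.mem_ker, map_commutatorElement, commutatorElement_eq_one_iff_mul_comm, mul_comm]
  | succ j ih =>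
    refine (Subgroup.commutator_mono ih le_rfl).trans (D.commutator_image_le fun a x hx => ?_)
    rw [pow_succ', Submodule.mul_smul]
    exact Submodule.smul_mem_smul (of_sub_one_mem_augIdeal a) hx

theorem unit_mem_pow_smul {K : Type*} [CommRing K] {j : ℕ} {x : M}
    (hx : x ∈ (augIdeal ℤ A ^ j • ⊤ : Submodule (MonoidAlgebra ℤ A) M)) :
    ExtendScalars.unit (grMap A (Int.castRingHom K)) M x ∈
      (augIdeal K A ^ j • ⊤ : Submodule (MonoidAlgebra K A) (MK A M K)) := by
  induction hx using Submodule.smul_induction_on' with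
  | smul i hi y _ =>
    rw [map_smulₛₗ]
    refine Submodule.smul_mem_smul ?_ Submodule.mem_top
    exact ((Ideal.pow_right_mono (augIdeal_le_comap A _) j).trans
      (Ideal.le_comap_pow (grMap A (Int.castRingHom K)) j)) hi
  | add x _ y _ h h' =>
    rw [map_add]
    exact Submodule.add_mem _ h h'

theorem unit_mem_of_mem_gammaZ {K : Type*} [CommRing K] {j m : ℕ} (hm : j + 2 ≤ m) {x : M}
    (hx : x ∈ D.inter (gammaZ G m)) :
    ExtendScalars.unit (grMap A (Int.castRingHom K)) M x ∈
      (augIdeal K A ^ j • ⊤ : Submodule (MonoidAlgebra K A) (MK A M K)) := by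
  refine unit_mem_pow_smul (D.ι_mem_image.1 (D.lowerCentralSeries_le j ?_))
  have h : D.ι (Multiplicative.ofAdd x) ∈ (⊤ : Subgroup G).lowerCentralSeries (m - 1) := hx
  exact (⊤ : Subgroup G).lowerCentralSeries_antitone (by omega) h

end Series

/-! ### The `n`-lower central series and the augmentation filtration. -/

section SeriesMod

theorem gammaModAux_antitone (n : ℕ) (G : Type*) [Group G] : Antitone (gammaModAux n G) := by
  refine antitone_nat_of_succ_le fun j => ?_
  have := gammaModAux_normal n G j
  refine sup_le (Subgroup.normalClosure_le_normal ?_) (Subgroup.commutator_le_left _ _)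
  rintro _ ⟨h, hh, rfl⟩
  exact Subgroup.pow_mem _ hh n

theorem map_gammaModAux_le (n : ℕ) {G Q : Type*} [Group G] [Group Q] (f : G →* Q)
    (hf : Function.Surjective f) (j : ℕ) :
    (gammaModAux n G j).map f ≤ gammaModAux n Q j := by
  induction j with
  | zero => exact le_top
  | succ j ih =>
    change Subgroup.map f (_ ⊔ _) ≤ _ ⊔ _
    rw [Subgroup.map_sup, Subgroup.map_normalClosure _ _ hf, Subgroup.map_commutator]
    refine sup_le_sup (Subgroup.normalClosure_mono ?_) (Subgroup.commutator_mono ih le_top)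
    rintro _ ⟨_, ⟨h, hh, rfl⟩, rfl⟩
    exact ⟨f h, ih ⟨h, hh, rfl⟩, (map_pow f h n).symm⟩

theorem gammaModAux_le_comap_powers (n : ℕ) {Q A : Type*} [Group Q] [CommGroup A] (π : Q →* A)
    (j : ℕ) : gammaModAux n Q j ≤ (powers A (n ^ j)).comap π := by
  induction j with
  | zero => exact fun g _ => ⟨π g, by simp⟩
  | succ j ih =>
    refine sup_le (Subgroup.normalClosure_le_normal ?_) ?_
    · rintro _ ⟨h, hh, rfl⟩
      obtain ⟨a, ha⟩ := ih hh
      refine ⟨a, ?_⟩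
      rw [map_pow, ← ha]
      simp [pow_mul, pow_succ]
    · rw [Subgroup.commutator_le]
      intro g _ h _
      have : π ⁅g, h⁆ = 1 := by
        rw [map_commutatorElement, commutatorElement_eq_one_iff_mul_comm, mul_comm]
      rw [Subgroup.mem_comap, this]
      exact Subgroup.one_mem _

/-- The subgroups of `n^s`-torsion form an ascending chain in a Noetherian `ℤ`-module. -/
theorem exists_pow_torsion_bound (n : ℕ) (A : Type*) [CommGroup A] [Group.FG A] :
    ∃ t : ℕ, ∀ (a : A) (s : ℕ), a ^ n ^ s = 1 → a ^ n ^ t = 1 := by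
  have : Module.Finite ℤ (Additive A) := Module.Finite.iff_addGroup_fg.2 inferInstance
  let f : ℕ →o Submodule ℤ (Additive A) :=
    { toFun := fun s => (LinearMap.lsmul ℤ (Additive A) ((n : ℤ) ^ s)).ker
      monotone' := fun s s' hs x hx => by
        obtain ⟨d, rfl⟩ := Nat.exists_eq_add_of_le hs
        simp only [LinearMap.mem_ker, LinearMap.lsmul_apply] at hx ⊢
        rw [pow_add, mul_comm, mul_smul, hx, smul_zero] }
  have hmem : ∀ s (a : A), Additive.ofMul a ∈ f s ↔ a ^ n ^ s = 1 := by
    intro s a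
    change ((n : ℤ) ^ s) • Additive.ofMul a = 0 ↔ _
    rw [← Nat.cast_pow, natCast_zsmul, ← ofMul_pow]
    rfl
  obtain ⟨t, ht⟩ := monotone_stabilizes_iff_noetherian.2 (inferInstance : IsNoetherian ℤ (Additive A)) f
  refine ⟨t, fun a s has => ?_⟩
  rw [← hmem] at has ⊢
  rcases le_total s t with h | h
  · exact f.mono h has
  · rwa [ht s h]

/-- In an extension of a finitely generated abelian group by an abelian group `L` of exponent `n`
on which the group acts nilpotently, the `n`-lower central series eventually meets `L` trivially. -/
theorem exists_gammaModAux_inf_ker_eq_bot (n : ℕ) {Q A : Type*} [Group Q] [CommGroup A]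
    [Group.FG A] (π : Q →* A) (hπ : Function.Surjective π) (hexp : ∀ x ∈ π.ker, x ^ n = 1)
    (c : ℕ) (hcent : ∀ g, ∀ x ∈ π.ker, Commute (g ^ n ^ c) x)
    (F : ℕ → Subgroup Q) (hFn : ∀ j, (F j).Normal) (hF0 : π.ker ≤ F 0) (hFle : ∀ j, F j ≤ π.ker)
    (hFc : F c = ⊥) (hF : ∀ j, ⁅F j, (⊤ : Subgroup Q)⁆ ≤ F (j + 1)) :
    ∃ m, gammaModAux n Q m ⊓ π.ker = ⊥ := by
  -- A conjugate of `p = g ^ n ^ c` is `l p` with `l` in the kernel. As `p` commutes with `l` and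
  -- `l^n = 1`, the `n`-th powers agree, so `p^n` is central.
  have hcentral : ∀ g h : Q, Commute (g ^ n ^ (c + 1)) h := by
    intro g h
    set p := g ^ n ^ c
    have hl : h * p * h⁻¹ * p⁻¹ ∈ π.ker := by
      rw [MonoidHom.mem_ker]
      simp only [map_mul, map_inv]
      rw [mul_right_comm (π h), mul_inv_cancel, one_mul, mul_inv_cancel]
    set l := h * p * h⁻¹ * p⁻¹ with hl'
    have h1 : h * p * h⁻¹ = l * p := by rw [hl', inv_mul_cancel_right]
    have h2 : (h * p * h⁻¹) ^ n = p ^ n := by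
      rw [h1, (hcent g l hl).symm.mul_pow, hexp l hl, one_mul]
    rw [conj_pow] at h2
    rw [pow_succ n, pow_mul]
    exact (mul_inv_eq_iff_eq_mul.1 h2).symm
  -- With exponent `n^(c+1)` powers are central and multiplicative up to a factor `l` in the kernel;
  -- one more `n`-th power removes `l`.
  have hmul : ∀ k (g h : Q), (g * h) ^ n ^ (c + 2 + k) = g ^ n ^ (c + 2 + k) * h ^ n ^ (c + 2 + k) := by
    intro k g h
    have hl : (g * h) ^ n ^ (c + 1) * (g ^ n ^ (c + 1) * h ^ n ^ (c + 1))⁻¹ ∈ π.ker := by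
      rw [MonoidHom.mem_ker]
      simp only [map_mul, map_inv, map_pow]
      rw [mul_pow, mul_inv_cancel]
    set l := (g * h) ^ n ^ (c + 1) * (g ^ n ^ (c + 1) * h ^ n ^ (c + 1))⁻¹ with hl'
    have h1 : (g * h) ^ n ^ (c + 1) = l * (g ^ n ^ (c + 1) * h ^ n ^ (c + 1)) := by
      rw [hl', inv_mul_cancel_right]
    have h2 : Commute l (g ^ n ^ (c + 1) * h ^ n ^ (c + 1)) :=
      (hcentral g l).symm.mul_right (hcentral h l).symm
    have h3 : ∀ x : Q, x ^ n ^ (c + 2 + k) = ((x ^ n ^ (c + 1)) ^ n) ^ n ^ k := by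
      intro x
      rw [← pow_mul, ← pow_mul]
      congr 1
      ring
    rw [h3, h1, h2.mul_pow, hexp l hl, one_mul, h3 g, h3 h, (hcentral g _).mul_pow,
      ((hcentral g _).pow_left n).mul_pow]
  obtain ⟨t, ht⟩ := exists_pow_torsion_bound n A
  -- The part `c + 2` makes the power map a homomorphism with central image. The extra `t + 1` is
  -- for the end: `n^t` sends an element whose image in `A` is `n`-power torsion into the kernel,
  -- and one more `n`-th power kills it.
  set e := c + 2 + (t + 1) with he
  let φ : Q →* Q := MonoidHom.mk' (fun g => g ^ n ^ e) (hmul (t + 1))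
  have hφ : ∀ g, φ g = g ^ n ^ e := fun g => rfl
  have hφc : ∀ g h, Commute (φ g) h := by
    intro g h
    have : n ^ e = n ^ (c + 1) * n ^ (t + 2) := by
      rw [← pow_add]
      congr 1
      omega
    rw [hφ, this, pow_mul]
    exact (hcentral g h).pow_left _
  have hφn : φ.range.Normal := ⟨by
    rintro _ ⟨g, rfl⟩ h
    rw [← (hφc g h).eq, mul_inv_cancel_right]
    exact ⟨g, rfl⟩⟩
  -- At stage `e` the image in `A` consists of `n^e`-th powers, so elements are in `φ(Q)` up to the
  -- kernel. After that, `n`-th powers kill the factor in `F j`, and commutators kill the central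
  -- factor in `φ(Q)` and move `F j` into `F (j + 1)`.
  have hle : ∀ j, gammaModAux n Q (e + j) ≤ φ.range ⊔ F j := by
    intro j
    induction j with
    | zero =>
      intro g hg
      obtain ⟨a, ha⟩ := gammaModAux_le_comap_powers n π e hg
      obtain ⟨b, rfl⟩ := hπ a
      refine (Subgroup.mem_sup_of_normal_left).2 ⟨φ b, ⟨b, rfl⟩, (φ b)⁻¹ * g, hF0 ?_, by simp⟩
      rw [MonoidHom.mem_ker, map_mul, map_inv, hφ, map_pow, ← ha]
      simp
    | succ j ih =>
      have := hFn j
      have := hFn (j + 1)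
      have hfact : ∀ g ∈ gammaModAux n Q (e + j), ∃ b, ∃ x ∈ F j, φ b * x = g := by
        intro g hg
        obtain ⟨_, ⟨b, rfl⟩, x, hx, h⟩ := (Subgroup.mem_sup_of_normal_left).1 (ih hg)
        exact ⟨b, x, hx, h⟩
      refine sup_le (Subgroup.normalClosure_le_normal ?_) ?_
      · rintro _ ⟨g, hg, rfl⟩
        obtain ⟨b, x, hx, rfl⟩ := hfact g hg
        refine Subgroup.mem_sup_left ?_
        rw [(hφc b x).mul_pow, hexp x (hFle j hx), mul_one]
        exact Subgroup.pow_mem _ (MonoidHom.mem_range.2 ⟨b, rfl⟩) n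
      · rw [Subgroup.commutator_le]
        intro g hg h _
        obtain ⟨b, x, hx, rfl⟩ := hfact g hg
        refine Subgroup.mem_sup_right (hF j ?_)
        have : ⁅φ b * x, h⁆ = ⁅x, h⁆ := by
          rw [commutatorElement_def, commutatorElement_def, mul_inv_rev, mul_assoc (φ b),
            mul_assoc (φ b), (hφc b _).eq]
          group
        rw [this]
        exact Subgroup.commutator_mem_commutator hx (Subgroup.mem_top h)
  refine ⟨e + c, ?_⟩
  rw [eq_bot_iff]
  rintro g ⟨hg, hgk⟩
  have h1 := hle c hg
  rw [hFc, sup_bot_eq] at h1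
  obtain ⟨b, rfl⟩ := h1
  have h2 : π b ^ n ^ t = 1 := by
    refine ht _ e ?_
    rw [← map_pow]
    exact hgk
  rw [← map_pow] at h2
  have h3 := hexp _ h2
  have h4 : n ^ e = n ^ t * n * n ^ (c + 2) := by
    rw [← pow_succ, ← pow_add]
    congr 1
    omega
  rw [Subgroup.mem_bot, hφ, h4, pow_mul, pow_mul, h3, one_pow]

variable {A : Type*} [CommGroup A] {M : Type*} [AddCommGroup M] [Module (MonoidAlgebra ℤ A) M]
  {G : Type*} [Group G] (D : Decomposition A M G)

/-- Let `b j` be the preimage in `M` of `I_K^j M_K`. In `G / b c` the image of `M` has exponent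
dividing `n`, because `n = 0` in `K`, and it is filtered by the `b j`; so the `n`-lower central
series eventually meets it trivially, that is, meets `M` inside `b c`. -/
theorem exists_unit_mem_of_mem_gammaMod [Group.FG A] (n : ℕ) (K : Type*) [CommRing K]
    [Algebra (ZMod n) K] (c : ℕ) :
    ∃ m₁, ∀ m ≥ m₁, ∀ x ∈ D.inter (gammaMod n G m),
      ExtendScalars.unit (grMap A (Int.castRingHom K)) M x ∈
        (augIdeal K A ^ c • ⊤ : Submodule (MonoidAlgebra K A) (MK A M K)) := by
  set u := ExtendScalars.unit (grMap A (Int.castRingHom K)) M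
  have hnK : (n : K) = 0 := by
    rw [← map_natCast (algebraMap (ZMod n) K), ZMod.natCast_self, map_zero]
  have hnΛ : (n : MonoidAlgebra K A) = 0 := by
    rw [← map_natCast (algebraMap K (MonoidAlgebra K A)), hnK, map_zero]
  let b : ℕ → Submodule (MonoidAlgebra ℤ A) M := fun j =>
    (augIdeal K A ^ j • ⊤ : Submodule (MonoidAlgebra K A) (MK A M K)).comap u
  have hb0 : b 0 = ⊤ := by
    simp only [b, pow_zero, Submodule.one_smul, Submodule.comap_top]
  have hmem : ∀ {j x}, x ∈ b j ↔
      u x ∈ (augIdeal K A ^ j • ⊤ : Submodule (MonoidAlgebra K A) (MK A M K)) := Iff.rfl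
  have hgr : ∀ (a : A) (x : M), u ((MonoidAlgebra.of ℤ A a - 1) • x) =
      (MonoidAlgebra.of K A a - 1) • u x := by
    intro a x
    rw [map_smulₛₗ]
    congr 1
    simp [MonoidAlgebra.of_apply]
  have hb : ∀ j a, ∀ x ∈ b j, (MonoidAlgebra.of ℤ A a - 1) • x ∈ b (j + 1) := by
    intro j a x hx
    rw [hmem, hgr, pow_succ', Submodule.mul_smul]
    exact Submodule.smul_mem_smul (of_sub_one_mem_augIdeal a) hx
  let q := QuotientGroup.mk' (D.image (b c))
  have hq : Function.Surjective q := QuotientGroup.mk'_surjective _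
  have hqι : ∀ x, q (D.ι (Multiplicative.ofAdd x)) = 1 ↔ x ∈ b c := by
    intro x
    rw [← D.ι_mem_image (S := b c)]
    exact QuotientGroup.eq_one_iff _
  have hker : D.image (b c) ≤ D.π.ker := by
    rw [← D.image_top]
    rintro _ ⟨x, -, rfl⟩
    exact ⟨x, trivial, rfl⟩
  let π' : G ⧸ D.image (b c) →* A := QuotientGroup.lift _ D.π hker
  have hπ' : ∀ g, π' (q g) = D.π g := fun g => rfl
  have hkerπ' : ∀ y ∈ π'.ker, ∃ x, q (D.ι (Multiplicative.ofAdd x)) = y := by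
    intro y hy
    obtain ⟨g, rfl⟩ := hq y
    have h : g ∈ D.ι.range := by
      rw [D.exact]
      exact hy
    obtain ⟨x, rfl⟩ := h
    exact ⟨x.toAdd, rfl⟩
  obtain ⟨m₁, hm₁⟩ := exists_gammaModAux_inf_ker_eq_bot n π'
    (fun a => by
      obtain ⟨g, hg⟩ := D.π_surjective a
      exact ⟨q g, hg⟩)
    (by
      intro y hy
      obtain ⟨x, rfl⟩ := hkerπ' y hy
      rw [← map_pow, ← map_pow, ← ofAdd_nsmul, hqι, hmem, map_nsmul, ← Nat.cast_smul_eq_nsmul (MonoidAlgebra K A), hnΛ, zero_smul]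
      exact Submodule.zero_mem _)
    c
    (by
      intro y z hz
      obtain ⟨x, rfl⟩ := hkerπ' z hz
      obtain ⟨g, rfl⟩ := hq y
      -- Since `n = 0` in `K`, `a ^ n ^ c - 1` lies in `I_K^c` for every `a ∈ A`; hence `g ^ n ^ c`
      -- centralizes `M / b c`.
      have h1 : (MonoidAlgebra.of ℤ A (D.π (g ^ n ^ c)) - 1) • x ∈ b c := by
        rw [hmem, hgr, map_pow, map_pow]
        refine Submodule.smul_mem_smul ?_ Submodule.mem_top
        exact pow_sub_one_mem n _ (by rw [hnΛ]; exact Ideal.zero_mem _)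
          (of_sub_one_mem_augIdeal _) c
      rw [← hqι, sub_smul, one_smul, ofAdd_sub, map_div, map_div, div_eq_one, D.conj] at h1
      simp only [map_mul, map_inv] at h1
      rw [← map_pow]
      rw [mul_assoc, inv_mul_eq_iff_eq_mul] at h1
      exact h1.symm)
    (fun j => (D.image (b j)).map q)
    (fun j => Subgroup.Normal.map inferInstance q hq)
    (by
      intro y hy
      obtain ⟨x, rfl⟩ := hkerπ' y hy
      refine ⟨_, D.ι_mem_image.2 ?_, rfl⟩
      rw [hb0]
      trivial)
    (by
      rintro j _ ⟨_, ⟨x, -, rfl⟩, rfl⟩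
      rw [MonoidHom.mem_ker, hπ', ← MonoidHom.mem_ker, ← D.exact]
      exact ⟨x, rfl⟩)
    (by
      rw [eq_bot_iff]
      rintro _ ⟨_, ⟨x, hx, rfl⟩, rfl⟩
      exact (hqι x.toAdd).2 hx)
    (by
      intro j
      rw [← Subgroup.map_top_of_surjective q hq, ← Subgroup.map_commutator]
      exact Subgroup.map_mono (D.commutator_image_le (hb j)))
  -- The shift accounts for `gammaMod` starting at index `1` and `gammaModAux` at `0`.
  refine ⟨m₁ + 1, fun m hm x hx => ?_⟩
  have h1 : D.ι (Multiplicative.ofAdd x) ∈ gammaModAux n G m₁ :=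
    gammaModAux_antitone n G (by omega : m₁ ≤ m - 1) hx
  have h2 : q (D.ι (Multiplicative.ofAdd x)) ∈ gammaModAux n _ m₁ ⊓ π'.ker := by
    refine ⟨map_gammaModAux_le n q hq m₁ ⟨_, h1, rfl⟩, ?_⟩
    change π' _ = 1
    rw [hπ', ← MonoidHom.mem_ker, ← D.exact]
    exact ⟨_, rfl⟩
  rw [hm₁] at h2
  exact (hqι x).1 h2

end SeriesMod

/-! ### The kernels of the projections `M_K → 𝓜^m_K` -/

section Projections

/-- `M_K` is an extension of scalars in one step, whereas `𝓜^m_K` passes through `R`; this supplies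
the intermediate map over `R[A]`. -/
theorem exists_semilinear_lift {Λ₀ Λ Λ' : Type*} [CommRing Λ₀] [CommRing Λ] [CommRing Λ']
    (f : Λ₀ →+* Λ) (f' : Λ →+* Λ') (f'' : Λ₀ →+* Λ') (hf : f'.comp f = f'') {M N : Type*}
    [AddCommGroup M] [Module Λ₀ M] [AddCommGroup N] [Module Λ' N] (g : M →ₛₗ[f''] N) :
    ∃ h : ExtendScalars f M →ₛₗ[f'] N, ∀ x, h (ExtendScalars.unit f M x) = g x := by
  subst hf
  let := Module.compHom N f'
  let g' : M →ₛₗ[f] N :=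
    { toFun := g
      map_add' := g.map_add
      map_smul' := fun c x => by
        rw [g.map_smulₛₗ]
        rfl }
  exact ⟨{ toFun := ExtendScalars.lift f g'
           map_add' := map_add _
           map_smul' := fun c x => (ExtendScalars.lift f g').map_smul c x },
    fun x => ExtendScalars.lift_unit f g' x⟩

theorem eq_of_eq_on_unit {Λ Λ' : Type*} [CommRing Λ] [CommRing Λ'] (f : Λ →+* Λ') {M N : Type*}
    [AddCommGroup M] [Module Λ M] [AddCommGroup N] [Module Λ' N]
    {g h : ExtendScalars f M →ₗ[Λ'] N}
    (hgh : ∀ x, g (ExtendScalars.unit f M x) = h (ExtendScalars.unit f M x)) : g = h :=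
  LinearMap.ext_on (ExtendScalars.span_range_unit f) (by
    rintro _ ⟨x, rfl⟩
    exact hgh x)

variable {A : Type*} [CommGroup A] {M : Type*} [AddCommGroup M] [Module (MonoidAlgebra ℤ A) M]
  {G : Type*} [Group G] (D : Decomposition A M G) {K : Type*} [CommRing K]

/-- If `S` contains the images of `γ_m(G) ∩ M`, the universal properties factor `M_K → M_K / S`
through `𝓜^m_K`, so the kernel of the projection maps to zero in `M_K / S`. -/
theorem ker_projKZ_le (R : Type) [CommRing R] [Algebra R K] (m : ℕ)
    (S : Submodule (MonoidAlgebra K A) (MK A M K))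
    (hS : ∀ x ∈ D.inter (gammaZ G m), ExtendScalars.unit (grMap A (Int.castRingHom K)) M x ∈ S) :
    (projKZ R D K m).ker ≤ S := by
  obtain ⟨h, hh⟩ := exists_semilinear_lift (grMap A (Int.castRingHom R))
    (grMap A (algebraMap R K)) (grMap A (Int.castRingHom K))
    (by
      rw [← MonoidAlgebra.mapRingHom_comp,
        RingHom.ext_int ((algebraMap R K).comp (Int.castRingHom R)) (Int.castRingHom K)])
    (S.mkQ.comp (ExtendScalars.unit (grMap A (Int.castRingHom K)) M))
  have hk : gammaTensor R D m ≤ h.ker := by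
    rw [gammaTensor, Submodule.span_le]
    rintro _ ⟨x, hx, rfl⟩
    change h _ = 0
    rw [hh]
    exact (Submodule.Quotient.mk_eq_zero S).2 (hS x hx)
  let ψ := ExtendScalars.lift (grMap A (algebraMap R K)) ((gammaTensor R D m).liftQ h hk)
  have hψ : ψ.comp (projKZ R D K m) = S.mkQ := by
    refine eq_of_eq_on_unit _ fun x => ?_
    rw [LinearMap.comp_apply, projKZ, ExtendScalars.lift_unit]
    change ψ (ExtendScalars.unit _ _ ((gammaTensor R D m).mkQ (ExtendScalars.unit _ _ x))) = _
    rw [ExtendScalars.lift_unit, Submodule.mkQ_apply, Submodule.liftQ_apply, hh]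
    rfl
  intro x hx
  rw [← Submodule.Quotient.mk_eq_zero S]
  have := LinearMap.congr_fun hψ x
  rw [LinearMap.comp_apply, LinearMap.mem_ker.1 hx, map_zero] at this
  exact this.symm

theorem ker_projKMod_le (n m : ℕ) (S : Submodule (MonoidAlgebra K A) (MK A M K))
    (hS : ∀ x ∈ D.inter (gammaMod n G m), ExtendScalars.unit (grMap A (Int.castRingHom K)) M x ∈ S) :
    (projKMod n D K m).ker ≤ S := by
  let h := S.mkQ.comp (ExtendScalars.unit (grMap A (Int.castRingHom K)) M)
  have hk : D.inter (gammaMod n G m) ≤ h.ker :=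
    fun x hx => (Submodule.Quotient.mk_eq_zero S).2 (hS x hx)
  let ψ := ExtendScalars.lift (grMap A (Int.castRingHom K)) ((D.inter (gammaMod n G m)).liftQ h hk)
  have hψ : ψ.comp (projKMod n D K m) = S.mkQ := by
    refine eq_of_eq_on_unit _ fun x => ?_
    rw [LinearMap.comp_apply, projKMod, ExtendScalars.lift_unit]
    change ψ (ExtendScalars.unit _ _ ((D.inter (gammaMod n G m)).mkQ x)) = _
    rw [ExtendScalars.lift_unit]
    rfl
  intro x hx
  rw [← Submodule.Quotient.mk_eq_zero S]
  have := LinearMap.congr_fun hψ x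
  rw [LinearMap.comp_apply, LinearMap.mem_ker.1 hx, map_zero] at this
  exact this.symm

theorem surjective_lift_of_span {Λ Λ' : Type*} [CommRing Λ] [CommRing Λ'] (f : Λ →+* Λ')
    {N : Type*} [AddCommGroup N] [Module Λ' N] {M : Type*} [AddCommGroup M] [Module Λ M]
    (g : M →ₛₗ[f] N) (hg : Submodule.span Λ' (Set.range g) = ⊤) :
    Function.Surjective (ExtendScalars.lift f g) := by
  rw [← LinearMap.range_eq_top, eq_top_iff, ← hg, Submodule.span_le]
  rintro _ ⟨x, rfl⟩
  exact ⟨ExtendScalars.unit f M x, ExtendScalars.lift_unit f g x⟩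

theorem span_range_toCalKMod (n m : ℕ) :
    Submodule.span (MonoidAlgebra K A) (Set.range (toCalKMod n D K m)) = ⊤ := by
  rw [eq_top_iff, ← ExtendScalars.span_range_unit]
  refine Submodule.span_mono ?_
  rintro _ ⟨y, rfl⟩
  obtain ⟨x, rfl⟩ := (D.inter (gammaMod n G m)).mkQ_surjective y
  exact ⟨x, rfl⟩

theorem mem_pow_smul_truncMK_of_liftQ_eq_zero {N : Type*} [AddCommGroup N]
    [Module (MonoidAlgebra K A) N] {m m₀ : ℕ} (p : MK A M K →ₗ[MonoidAlgebra K A] N)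
    (hp : (augIdeal K A ^ m • ⊤ : Submodule (MonoidAlgebra K A) (MK A M K)) ≤ p.ker)
    (hk : p.ker ≤ augIdeal K A ^ m₀ • ⊤) {x : truncMK A M K m}
    (hx : Submodule.liftQ _ p hp x = 0) :
    x ∈ (augIdeal K A ^ m₀ • ⊤ : Submodule (MonoidAlgebra K A) (truncMK A M K m)) := by
  obtain ⟨x, rfl⟩ := Submodule.mkQ_surjective _ x
  have h : x ∈ (augIdeal K A ^ m₀ • ⊤ : Submodule (MonoidAlgebra K A) (MK A M K)) := hk hx
  have h1 := Submodule.mem_map_of_mem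
    (f := (augIdeal K A ^ m • ⊤ : Submodule (MonoidAlgebra K A) (MK A M K)).mkQ) h
  rw [Submodule.map_smul''] at h1
  exact Submodule.smul_mono le_rfl le_top h1

end Projections

end Metabelian

end

/-! ### The theorem, for `ℤ[J⁻¹]` and for `ℤ/n`. -/

open Metabelian
theorem proposition7p2 {A : Type*} [CommGroup A] [Group.FG A]
    {M : Type*} [AddCommGroup M] [Module (MonoidAlgebra ℤ A) M] (hM : IsTame A M)
    {G : Type*} [Group G] (D : Decomposition A M G) :
    -- The case `R = ℤ[J⁻¹]`, `K` an Artinian quotient ring of `R`.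
    (∀ (J : Set ℕ) (_ : ∀ p ∈ J, p.Prime) (K : Type*) [CommRing K] [IsArtinianRing K]
      [Algebra (ZInv J) K] (_ : Function.Surjective (algebraMap (ZInv J) K)),
      Representation.Coinvariants.ker (extSq (hatActionZ (A := A) J K M)) =
        Representation.Coinvariants.ker (extSq (actA A K (hatMK A M K))) ∧
      InducesIso (actA A K (locMK A M K)) (actA A K (hatMK A M K))
        (locToCompletion (augIdeal K A) (MK A M K)) ∧
      ∃ m₀ : ℕ, ∀ m ≥ m₀,
        InducesIso (actA A K (hatMK A M K)) (actA A K (truncMK A M K m))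
          (AdicCompletion.eval (augIdeal K A) (MK A M K) m) ∧
        InducesIso (actA A K (truncMK A M K m)) (calActionZ J D K m)
          (truncToCalKZ (ZInv J) D K m)) ∧
    -- The case `R = ℤ/n`, `K` an Artinian quotient ring of `R`.
    (∀ (n : ℕ) (_ : n ≠ 0) (K : Type*) [CommRing K] [IsArtinianRing K]
      [Algebra (ZMod n) K] (_ : Function.Surjective (algebraMap (ZMod n) K)),
      Representation.Coinvariants.ker (extSq (hatActionMod (A := A) n K M)) =
        Representation.Coinvariants.ker (extSq (actA A K (hatMK A M K))) ∧
      InducesIso (actA A K (locMK A M K)) (actA A K (hatMK A M K))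
        (locToCompletion (augIdeal K A) (MK A M K)) ∧
      ∃ m₀ : ℕ, ∀ m ≥ m₀,
        InducesIso (actA A K (hatMK A M K)) (actA A K (truncMK A M K m))
          (AdicCompletion.eval (augIdeal K A) (MK A M K) m) ∧
        InducesIso (actA A K (truncMK A M K m)) (calActionMod n D K m)
          (truncToCalKMod n D K m)) := by
  refine ⟨?_, ?_⟩
  · intro J _ K _ _ _ hsurj
    obtain ⟨m₀, r, hr1, hr⟩ := hM.exists_mul_pow_mem K
    have hK := hasIntFractions_of_ZInv J hsurj
    have hθ := isUnitaryExtension_thetaKZ (A := A) J K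
    -- The bound is `m₀ + 2` because `γ_{j+2}(G) ∩ M` lies in `M I^j`.
    refine ⟨coinvariants_ker_actionVia_hatMK hr1 hr hK hθ, inducesIso_locToCompletion hr1 hr,
      m₀ + 2, fun m hm => ⟨inducesIso_eval hr1 hr (by omega), ?_⟩⟩
    refine inducesIso_truncMK_of_lifts hr1 hr hK (by omega : m₀ ≤ m) _ _ ?_ ?_ ?_ ?_
    · intro y
      obtain ⟨x, rfl⟩ := surjective_lift_of_span _ _ (span_range_toCalKZ (ZInv J) D K m) y
      exact ⟨Submodule.Quotient.mk x, rfl⟩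
    · intro x hx
      exact mem_pow_smul_truncMK_of_liftQ_eq_zero _ _
        (ker_projKZ_le D (ZInv J) m _ fun x hx => unit_mem_of_mem_gammaZ D hm hx) hx
    · intro a
      obtain ⟨h, hh⟩ := hθ.extends_of a
      exact ⟨h, actionViaCompletion_apply _ (pow_smul_calKZ (ZInv J) D K m) (hh m)⟩
    · intro h
      obtain ⟨l, hl, hl1⟩ := hθ.unitary h m
      exact ⟨l, actionViaCompletion_apply _ (pow_smul_calKZ (ZInv J) D K m) hl, hl1⟩
  · intro n _ K _ _ _ hsurj
    obtain ⟨m₀, r, hr1, hr⟩ := hM.exists_mul_pow_mem K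
    have hK := hasIntFractions_of_ZMod n hsurj
    have hθ := isUnitaryExtension_thetaKMod (A := A) n K
    obtain ⟨m₁, hm₁⟩ := exists_unit_mem_of_mem_gammaMod D n K m₀
    -- Here `m₀` serves the vanishing of wedges, and `m₁` puts `γ_m^{[n]}(G) ∩ M` into `I^m₀ M_K`.
    refine ⟨coinvariants_ker_actionVia_hatMK hr1 hr hK hθ, inducesIso_locToCompletion hr1 hr,
      max m₀ m₁, fun m hm => ⟨inducesIso_eval hr1 hr (le_of_max_le_left hm), ?_⟩⟩
    refine inducesIso_truncMK_of_lifts hr1 hr hK (le_of_max_le_left hm) _ _ ?_ ?_ ?_ ?_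
    · intro y
      obtain ⟨x, rfl⟩ := surjective_lift_of_span _ _ (span_range_toCalKMod (K := K) D n m) y
      exact ⟨Submodule.Quotient.mk x, rfl⟩
    · intro x hx
      exact mem_pow_smul_truncMK_of_liftQ_eq_zero _ _
        (ker_projKMod_le D n m _ (hm₁ m (le_of_max_le_right hm))) hx
    · intro a
      exact ⟨QuotientGroup.mk a, fun x => rfl⟩
    · intro h
      obtain ⟨a, rfl⟩ := QuotientGroup.mk_surjective h
      refine ⟨MonoidAlgebra.of K A a, fun x => rfl, ?_⟩
      rw [involution_of, ← map_mul, inv_mul_cancel, map_one, sub_self]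
      exact Ideal.zero_mem _
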